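/- Let $Q$ be a finite quiver (loops and multiple arrows allowed). Write $H_1(Q,\mathbb{Z})$ for the first homology group of its underlying graph. Call $Q$ a \emph{pseudotree} if it is connected (and nonempty) and $\operatorname{rank} H_1(Q,\mathbb{Z})\le 1$. It is \emph{a tree} if it is connected and $H_1(Q,\mathbb{Z})=0$, \emph{of type $\tilde{\mathbb{A}}$} if it is an arbitrary orientation of a simple cycle with $n\ge 1$ vertices and $n$ arrows (a loop for $n=1$, two arrows joining two vertices for $n=2$), and a \emph{proper pseudotree} if it is a pseudotree that is neither a tree nor of type $\tilde{\mathbb{A}}$. An $\mathbb{F}_1$-vector space is a finite pointed set $(V,0)$, of dimension $|V|-1$; an $\mathbb{F}_1$-linear map $f:V\to W$ is a pointed map that is injective on $V\setminus f^{-1}(0)$; the direct sum is the wedge $V\vee W$. An $\mathbb{F}_1$-representation $M$ of $Q$ consists of $\mathbb{F}_1$-vector spaces $M_i$ for the vertices $i$ and $\mathbb{F}_1$-linear maps $M_{s(\alpha)}\to M_{t(\alpha)}$ for the arrows $\alpha$; its dimension is $\dim M=\sum_i \dim M_i$. It is \emph{nilpotent} if for some $n$ the composite map along every oriented path of length at least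 $n$ is zero, and \emph{indecomposable} if it is nonzero and not isomorphic to a direct sum of two nonzero representations. The Hall algebra $H_{Q,\mathrm{nil}}$ is the $\mathbb{C}$-vector space with basis the isomorphism classes $[M]$ of nilpotent representations and with product $$[M]\cdot[N]=\sum_{[R]}\frac{a^R_{M,N}}{a_M a_N}[R],$$ where $a_M=|\operatorname{Aut}(M)|$ and $a^R_{M,N}$ is the number of short exact sequences $0\to N\to R\to M\to 0$. Let $[x,y]=x\cdot y-y\cdot x$ be its commutator; this is the bracket of the Lie algebra $\mathfrak{n}_{Q,\mathrm{nil}}$ spanned by the classes of nilpotent indecomposable representations. Let $Q$ be a (not necessarily proper) pseudotree. Then the following hold. \begin{enumerate} \item If $Q$ is a tree, then there is a natural number $K$ such that $[[N],[M]]=0$ for all nilpotent indecomposable $\mathbb{F}_1$-representations $M,N$ of $Q$ with $\max\{\dim M,\dim N\}\ge K$. \item If $Q$ is of type $\tilde{\mathbb{A}}$, then there are natural numbers $K,B$ such that, for all nilpotent indecomposable $\mathbb{F}_1$-representations $M,N$ of $Q$ with $\max\{\dim M,\dim N\}\ge K$, the bracket $[[N],[M]]$ is a $\mathbb{Z}$-linear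 combination of at most $B$ classes of nilpotent indecomposable representations. \item If $Q$ is a proper pseudotree, then there is a natural number $K$ such that, for all nilpotent indecomposable $\mathbb{F}_1$-representations $M,N$ of $Q$ with $\max\{\dim M,\dim N\}\ge K$, the bracket $[[N],[M]]$ is a $\mathbb{Z}$-linear combination of at most $\max\{\dim M,\dim N\}$ classes of nilpotent indecomposable representations. \end{enumerate} -/

import Mathlib

open CategoryTheory

universe v u

/-! ### Quivers

A quiver is Mathlib's `Quiver Q` on a finite type `Q` of vertices with finite types of arrows;
`Quiver.Total Q` is the type of all arrows, loops and multiple arrows being allowed. -/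

/-- The boundary map `α ↦ t(α) - s(α)` from 1-chains to 0-chains of the underlying graph. -/
noncomputable def quiverBoundary (Q : Type u) [Quiver.{v} Q] :
    (Quiver.Total Q →₀ ℤ) →ₗ[ℤ] (Q →₀ ℤ) :=
  Finsupp.linearCombination ℤ fun a : Quiver.Total Q =>
    (Finsupp.single a.right 1 - Finsupp.single a.left 1 : Q →₀ ℤ)

/-- `H₁(Q, ℤ)`, the first homology group of the underlying graph (a one-dimensional complex):
the group of 1-cycles. -/
noncomputable abbrev quiverH1 (Q : Type u) [Quiver.{v} Q] : Submodule ℤ (Quiver.Total Q →₀ ℤ) :=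
  LinearMap.ker (quiverBoundary Q)

/-- The underlying graph is nonempty and connected. -/
def IsConnectedQuiver (Q : Type u) [Quiver.{v} Q] : Prop :=
  Nonempty Q ∧ Subsingleton (Quiver.WeaklyConnectedComponent Q)

/-- A pseudotree is a connected quiver with `rank H₁(Q, ℤ) ≤ 1`. -/
def IsPseudotree (Q : Type u) [Quiver.{v} Q] : Prop :=
  IsConnectedQuiver Q ∧ Module.finrank ℤ (quiverH1 Q) ≤ 1

/-- The underlying graph is a tree: it is connected and has no cycles, that is, `H₁(Q, ℤ) = 0`. -/
def IsTreeQuiver (Q : Type u) [Quiver.{v} Q] : Prop :=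
  IsConnectedQuiver Q ∧ quiverH1 Q = ⊥

/-- Type `Ã`: an arbitrary orientation of a simple cycle with `n ≥ 1` vertices and `n` arrows.
The cycle with `n = 1` is the loop, the cycle with `n = 2` a pair of arrows joining two vertices. -/
def IsTypeATilde (Q : Type u) [Quiver.{v} Q] : Prop :=
  ∃ n : ℕ, 1 ≤ n ∧ ∃ (e : ZMod n ≃ Q) (a : ZMod n ≃ Quiver.Total Q), ∀ i : ZMod n,
    ((a i).left = e i ∧ (a i).right = e (i + 1)) ∨
    ((a i).left = e (i + 1) ∧ (a i).right = e i)

/-- A proper pseudotree is a pseudotree which is neither a tree nor of type `Ã`. -/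
def IsProperPseudotree (Q : Type u) [Quiver.{v} Q] : Prop :=
  IsPseudotree Q ∧ ¬ IsTreeQuiver Q ∧ ¬ IsTypeATilde Q

/-! ### Vector spaces over `𝔽₁` -/

/-- An `𝔽₁`-vector space: a finite pointed set. -/
structure F1Space where
  carrier : Type
  zero : carrier
  finite : Finite carrier

instance (V : F1Space) : Finite V.carrier := V.finite

/-- The dimension `|V| - 1`, as the number of nonzero elements. -/
noncomputable def F1Space.dim (V : F1Space) : ℕ := Nat.card {x : V.carrier // x ≠ V.zero}

/-- An `𝔽₁`-linear map: a pointed map that is injective outside the preimage of zero. -/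
@[ext] structure F1Hom (V W : F1Space) where
  toFun : V.carrier → W.carrier
  map_zero : toFun V.zero = W.zero
  inj : ∀ x y, toFun x ≠ W.zero → toFun x = toFun y → x = y

instance (V W : F1Space) : CoeFun (F1Hom V W) fun _ => V.carrier → W.carrier := ⟨F1Hom.toFun⟩

def F1Hom.id (V : F1Space) : F1Hom V V := ⟨fun x => x, rfl, fun _ _ _ h => h⟩

def F1Hom.comp {U V W : F1Space} (g : F1Hom V W) (f : F1Hom U V) : F1Hom U W where
  toFun x := g (f x)
  map_zero := by rw [f.map_zero, g.map_zero]
  inj x y hx h := f.inj x y (fun h0 => hx (by rw [h0, g.map_zero])) (g.inj _ _ hx h)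

/-- The direct sum of pointed sets is the wedge `V ∨ W`, realised as the set of the pairs in
`V × W` with at least one coordinate zero. -/
def F1Space.sum (V W : F1Space) : F1Space where
  carrier := {p : V.carrier × W.carrier // p.1 = V.zero ∨ p.2 = W.zero}
  zero := ⟨(V.zero, W.zero), Or.inl rfl⟩
  finite := inferInstance

def F1Hom.sum {V W V' W' : F1Space} (f : F1Hom V V') (g : F1Hom W W') :
    F1Hom (V.sum W) (V'.sum W') where
  toFun p := ⟨(f p.1.1, g p.1.2), p.2.imp (fun h => by rw [h, f.map_zero])
    (fun h => by rw [h, g.map_zero])⟩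
  map_zero := Subtype.ext (Prod.ext f.map_zero g.map_zero)
  inj := by
    rintro ⟨⟨x, y⟩, h⟩ ⟨⟨x', y'⟩, h'⟩ h0 he
    have e1 : f x = f x' := congrArg (fun p => p.1.1) he
    have e2 : g y = g y' := congrArg (fun p => p.1.2) he
    apply Subtype.ext
    by_cases hx : f x = V'.zero
    · have hy : g y ≠ W'.zero := fun hy => h0 (Subtype.ext (Prod.ext hx hy))
      have hyy : y = y' := g.inj y y' hy e2
      have hy0 : y ≠ W.zero := fun h2 => hy (by rw [h2, g.map_zero])
      exact Prod.ext ((h.resolve_right hy0).trans (h'.resolve_right (hyy ▸ hy0)).symm) hyy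
    · have hxx : x = x' := f.inj x x' hx e1
      have hx0 : x ≠ V.zero := fun h2 => hx (by rw [h2, f.map_zero])
      exact Prod.ext hxx ((h.resolve_left hx0).trans (h'.resolve_left (hxx ▸ hx0)).symm)

/-! ### Representations of a quiver over `𝔽₁` -/

/-- An `𝔽₁`-representation of `Q`. -/
structure F1Rep (Q : Type u) [Quiver.{v} Q] where
  obj : Q → F1Space
  map : ∀ {i j : Q}, (i ⟶ j) → F1Hom (obj i) (obj j)

/-- A morphism of representations. -/
@[ext] structure F1RepHom {Q : Type u} [Quiver.{v} Q] (M N : F1Rep Q) where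
  app : ∀ i, F1Hom (M.obj i) (N.obj i)
  naturality : ∀ {i j : Q} (α : i ⟶ j), (app j).comp (M.map α) = (N.map α).comp (app i)

/-- The category `Rep(Q, 𝔽₁)`. -/
instance F1Rep.category (Q : Type u) [Quiver.{v} Q] : Category (F1Rep Q) where
  Hom M N := F1RepHom M N
  id M := ⟨fun i => F1Hom.id (M.obj i), fun _ => rfl⟩
  comp f g := ⟨fun i => (g.app i).comp (f.app i), fun {i j} α => by
    have h1 := f.naturality α
    have h2 := g.naturality α
    apply F1Hom.ext
    funext x
    have h1' := congrFun (congrArg F1Hom.toFun h1) x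
    have h2' := congrFun (congrArg F1Hom.toFun h2) (f.app i x)
    simp only [F1Hom.comp] at h1' h2' ⊢
    rw [h1', h2']⟩
  id_comp _ := rfl
  comp_id _ := rfl
  assoc _ _ _ := rfl

namespace F1Rep

variable {Q : Type u} [Quiver.{v} Q]

/-- The dimension of a representation. -/
noncomputable def dim [Fintype Q] (M : F1Rep Q) : ℕ := ∑ i, (M.obj i).dim

/-- The map `f_{αₙ} ∘ ⋯ ∘ f_{α₁}` along an oriented path `α₁ ⋯ αₙ`. -/
def mapPath (M : F1Rep Q) {i : Q} : ∀ {j : Q}, Quiver.Path i j → F1Hom (M.obj i) (M.obj j)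
  | _, .nil => F1Hom.id _
  | _, .cons p α => (M.map α).comp (M.mapPath p)

/-- Nilpotent: the maps along all sufficiently long oriented paths are zero. -/
def IsNilpotent (M : F1Rep Q) : Prop :=
  ∃ n : ℕ, ∀ (i j : Q) (p : Quiver.Path i j), n ≤ p.length →
    ∀ x, M.mapPath p x = (M.obj j).zero

/-- The zero representations. -/
def IsZero (M : F1Rep Q) : Prop := ∀ i, ∀ x : (M.obj i).carrier, x = (M.obj i).zero

/-- The direct sum of two representations. -/
def sum (M N : F1Rep Q) : F1Rep Q where
  obj i := (M.obj i).sum (N.obj i)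
  map α := (M.map α).sum (N.map α)

/-- Indecomposable: nonzero, and not isomorphic to a direct sum of two nonzero representations. -/
def Indecomposable (M : F1Rep Q) : Prop :=
  ¬ M.IsZero ∧ ∀ A B : F1Rep Q, Nonempty (M ≅ A.sum B) → A.IsZero ∨ B.IsZero

/-- The short exact sequences `0 ⟶ N ⟶ R ⟶ M ⟶ 0` with the given terms. -/
structure ShortExact (N R M : F1Rep Q) where
  f : F1RepHom N R
  g : F1RepHom R M
  inj : ∀ i, Function.Injective (f.app i)
  surj : ∀ i, Function.Surjective (g.app i)
  exact : ∀ i x, g.app i x = (M.obj i).zero ↔ ∃ y, f.app i y = x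

end F1Rep

/-- Nilpotent representations up to isomorphism. -/
def nilSetoid (Q : Type u) [Quiver.{v} Q] : Setoid {M : F1Rep Q // M.IsNilpotent} where
  r M N := Nonempty (M.1 ≅ N.1)
  iseqv := ⟨fun M => ⟨Iso.refl M.1⟩, fun ⟨e⟩ => ⟨e.symm⟩, fun ⟨e⟩ ⟨e'⟩ => ⟨e.trans e'⟩⟩

/-- The set of isomorphism classes of nilpotent `𝔽₁`-representations of `Q`. -/
def NilIso (Q : Type u) [Quiver.{v} Q] := Quotient (nilSetoid Q)

/-- A representative of an isomorphism class. -/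
noncomputable def NilIso.rep {Q : Type u} [Quiver.{v} Q] (X : NilIso Q) : F1Rep Q :=
  (Quotient.out (s := nilSetoid Q) X).1

/-! ### The Hall algebra -/

section Finiteness

variable {Q : Type u} [Quiver.{v} Q]

/-- The representations on the fixed sets of vertices `Fin (d i)`. -/
def stdRep (d : Q → ℕ) (z : ∀ i, Fin (d i))
    (m : ∀ a : Quiver.Total Q, F1Hom ⟨Fin (d a.left), z a.left, inferInstance⟩
      ⟨Fin (d a.right), z a.right, inferInstance⟩) : F1Rep Q where
  obj i := ⟨Fin (d i), z i, inferInstance⟩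
  map {i j} α := m ⟨i, j, α⟩

instance F1Hom.finite (V W : F1Space) : Finite (F1Hom V W) :=
  Finite.of_injective F1Hom.toFun fun _ _ h => F1Hom.ext h

instance Quiver.Total.finite [Finite Q] [∀ i j : Q, Finite (i ⟶ j)] :
    Finite (Quiver.Total Q) :=
  Finite.of_injective (β := Σ p : Q × Q, (p.1 ⟶ p.2)) (fun a => ⟨(a.left, a.right), a.hom⟩) <| by
    rintro ⟨i, j, α⟩ ⟨i', j', α'⟩ h
    obtain ⟨⟨h1, h2⟩, h3⟩ := by simpa using h
    subst h1; subst h2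
    simpa using h3

theorem exists_iso_stdRep (R : F1Rep Q) (d : Q → ℕ)
    (hd : ∀ i, Nat.card (R.obj i).carrier = d i) :
    ∃ z m, Nonempty (R ≅ stdRep d z m) := by
  let e : ∀ i, (R.obj i).carrier ≃ Fin (d i) := fun i => Finite.equivFinOfCardEq (hd i)
  refine ⟨fun i => e i (R.obj i).zero, fun a =>
    ⟨fun x => e _ (R.map a.hom ((e _).symm x)), by simp [F1Hom.map_zero], ?_⟩, ⟨?_⟩⟩
  · intro x y h1 h2
    have h1' : R.map a.hom ((e _).symm x) ≠ (R.obj a.right).zero := fun h => h1 (by rw [h])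
    exact (e _).symm.injective ((R.map a.hom).inj _ _ h1' ((e _).injective h2))
  · exact
      { hom := ⟨fun i => ⟨e i, rfl, fun x y _ h => (e i).injective h⟩, fun {i j} α =>
          F1Hom.ext <| funext fun x => by simp [F1Hom.comp, stdRep]⟩
        inv := ⟨fun i => ⟨(e i).symm, (e i).symm_apply_apply _,
          fun x y _ h => (e i).symm.injective h⟩, fun {i j} α =>
          F1Hom.ext <| funext fun x => by simp [F1Hom.comp, stdRep]⟩
        hom_inv_id := F1RepHom.ext <| funext fun i => F1Hom.ext <| funext fun x =>
          (e i).symm_apply_apply x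
        inv_hom_id := F1RepHom.ext <| funext fun i => F1Hom.ext <| funext fun x =>
          (e i).apply_symm_apply x }

theorem F1Rep.ShortExact.card_le {N R M : F1Rep Q} (s : F1Rep.ShortExact N R M) (i : Q) :
    Nat.card (R.obj i).carrier ≤ Nat.card (N.obj i).carrier + Nat.card (M.obj i).carrier := by
  classical
  rw [← Nat.card_sum]
  have hk : ∀ x, s.g.app i x = (M.obj i).zero → ∃ y, s.f.app i y = x := fun x =>
    (s.exact i x).1
  refine Nat.card_le_card_of_injective (fun x => if h : s.g.app i x = (M.obj i).zero then
    Sum.inl (hk x h).choose else Sum.inr (s.g.app i x)) ?_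
  intro x y hxy
  by_cases hx : s.g.app i x = (M.obj i).zero <;> by_cases hy : s.g.app i y = (M.obj i).zero <;>
    simp only [hx, hy, dite_true, dite_false, Sum.inl.injEq, Sum.inr.injEq, reduceCtorEq] at hxy
  · rw [← (hk x hx).choose_spec, ← (hk y hy).choose_spec, hxy]
  · exact (s.g.app i).inj x y hx hxy

/-- Only finitely many isomorphism classes occur as extensions. -/
theorem finite_setOf_shortExact [Finite Q] [∀ i j : Q, Finite (i ⟶ j)] (N M : F1Rep Q) :
    {X : NilIso Q | Nonempty (F1Rep.ShortExact N X.rep M)}.Finite := by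
  classical
  let b : Q → ℕ := fun i => Nat.card (N.obj i).carrier + Nat.card (M.obj i).carrier
  let D := Σ d : (∀ i, Fin (b i + 1)), Σ z : (∀ i, Fin (d i : ℕ)),
    ∀ a : Quiver.Total Q, F1Hom ⟨Fin (d a.left : ℕ), z a.left, inferInstance⟩
      ⟨Fin (d a.right : ℕ), z a.right, inferInstance⟩
  have key : ∀ X : {X : NilIso Q | Nonempty (F1Rep.ShortExact N X.rep M)},
      ∃ t : D, Nonempty (X.1.rep ≅ stdRep (fun i => (t.1 i : ℕ)) t.2.1 t.2.2) := by
    rintro ⟨X, ⟨s⟩⟩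
    obtain ⟨z, m, h⟩ := exists_iso_stdRep X.rep
      (fun i => ((⟨Nat.card (X.rep.obj i).carrier, Nat.lt_succ_of_le (s.card_le i)⟩ :
        Fin (b i + 1)) : ℕ)) (fun i => rfl)
    exact ⟨⟨_, z, m⟩, h⟩
  choose t ht using key
  refine Set.finite_coe_iff.1 ?_
  refine Finite.of_injective t fun X Y h => ?_
  have hX := ht X
  have hY := ht Y
  rw [← h] at hY
  obtain ⟨eX⟩ := hX
  obtain ⟨eY⟩ := hY
  exact Subtype.ext (Quotient.out_equiv_out.1 ⟨eX.trans eY.symm⟩)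

end Finiteness

section Hall

variable {Q : Type u} [Quiver.{v} Q]

/-- The underlying space of the Hall algebra of nilpotent representations: the finitely supported
complex functions on the isomorphism classes. -/
abbrev HallAlg (Q : Type u) [Quiver.{v} Q] := NilIso Q →₀ ℂ

/-- The delta function `[M]`. -/
noncomputable def hallClass (M : F1Rep Q) (hM : M.IsNilpotent) : HallAlg Q :=
  Finsupp.single (Quotient.mk (nilSetoid Q) ⟨M, hM⟩) 1

/-- The number `a_M` of automorphisms. -/
noncomputable def autCard (M : F1Rep Q) : ℕ := Nat.card (Aut M)

/-- `x` is a `ℤ`-linear combination of at most `B` classes of nilpotent indecomposables. -/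
def IsIntCombOfIndecomposables (B : ℕ) (x : HallAlg Q) : Prop :=
  ∃ m : ℕ, m ≤ B ∧ ∃ (c : Fin m → ℤ) (R : Fin m → F1Rep Q) (hR : ∀ k, (R k).IsNilpotent),
    (∀ k, (R k).Indecomposable) ∧ x = ∑ k, c k • hallClass (R k) (hR k)

variable [Finite Q] [∀ i j : Q, Finite (i ⟶ j)]

/-- The product `[M] · [N] = ∑_R (a^R_{M,N} / (a_M a_N)) [R]` of two isomorphism classes, where
`a^R_{M,N}` is the number of short exact sequences `0 ⟶ N ⟶ R ⟶ M ⟶ 0`. -/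
noncomputable def hallProd (X Y : NilIso Q) : HallAlg Q :=
  Finsupp.onFinset (finite_setOf_shortExact Y.rep X.rep).toFinset
    (fun Z => (Nat.card (F1Rep.ShortExact Y.rep Z.rep X.rep) : ℂ) /
      ((autCard X.rep : ℂ) * (autCard Y.rep : ℂ)))
    (fun Z hZ => by
      rw [Set.Finite.mem_toFinset, Set.mem_ofPred_eq]
      by_contra h
      rw [not_nonempty_iff] at h
      exact hZ (by simp))

/-- The bilinear extension of the product to the Hall algebra. -/
noncomputable def hallMul (x y : HallAlg Q) : HallAlg Q :=
  x.sum fun X a => y.sum fun Y b => (a * b) • hallProd X Y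

/-- The commutator in the Hall algebra; on the span of the classes of the nilpotent
indecomposables this is the bracket of the Lie algebra `𝔫_{Q,nil}`. -/
noncomputable def hallBracket (x y : HallAlg Q) : HallAlg Q := hallMul x y - hallMul y x

end Hall

/-! A representation is encoded by its coefficient quiver, whose vertices are the nonzero elements
and whose arrows are the nonzero values of the structure maps. By `𝔽₁`-linearity a signed arrow of
`Q` lifts in at most one way from a given point, so walks lift uniquely (`Step.functional`). A
representation is indecomposable exactly when its coefficient quiver is connected.

The middle term of a short exact sequence is a `Gluing`: the disjoint union of the two coefficient
quivers plus some connecting arrows. Between connected ends, a disconnected middle term comes from a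
split sequence and occurs equally often in both orders (`card_le_card_swap`), so it cancels in the
commutator. The coefficients are integers because the automorphisms of the ends act freely on the
sequences (`exists_card_eq`). It remains to count connected gluings up to isomorphism.

The count rests on `rank H₁ ≤ 1`: the arrows occurring in 1-cycles form at most one simple cycle,
the core. Reduced walks between core vertices stay in the core, and in a connected representation at
most one point fails to lift a given signed core arrow (`Misses.unique`). If `dim M > |Q|`, two
points lie over one vertex, which yields a reduced closed walk, and `M` meets the core. On a tree
this is impossible, so the first claim is vacuous for large `K`. Otherwise there are two cases. If
both representations meet the core, as always happens in type `Ã`, all connecting arrows are core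
arrows, their ends are forced, and the gluing is determined by a set of signed arrows: a bound
depending on `Q` only. If `N` avoids the core, there is exactly one connecting arrow, with forced
label and forced end in `N` (`conn_unique`), leaving at most `dim M` choices. For large `K` the
constant bound is absorbed by the dimension. -/

/-! ### Walks in the underlying graph -/

/-- An arrow with a direction of travel: `true` along the arrow, `false` against it. -/
abbrev SignedArrow (Q : Type u) [Quiver.{v} Q] := Bool × Quiver.Total Q

namespace SignedArrow

variable {Q : Type u} [Quiver.{v} Q]

def src (e : SignedArrow Q) : Q := if e.1 then e.2.left else e.2.right

def tgt (e : SignedArrow Q) : Q := if e.1 then e.2.right else e.2.left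

def inv (e : SignedArrow Q) : SignedArrow Q := (!e.1, e.2)

@[simp] theorem inv_inv (e : SignedArrow Q) : e.inv.inv = e := by simp [inv]

@[simp] theorem inv_snd (e : SignedArrow Q) : e.inv.2 = e.2 := rfl

@[simp] theorem src_inv (e : SignedArrow Q) : e.inv.src = e.tgt := by
  rcases e with ⟨_ | _, a⟩ <;> rfl

@[simp] theorem tgt_inv (e : SignedArrow Q) : e.inv.tgt = e.src := by
  rcases e with ⟨_ | _, a⟩ <;> rfl

theorem eq_or_eq_inv {e f : SignedArrow Q} (h : e.2 = f.2) : e = f ∨ e = f.inv := by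
  rcases e with ⟨_ | _, a⟩ <;> rcases f with ⟨_ | _, b⟩ <;> simp_all [inv]

/-- The sequence of signed arrows is a walk from `x` to `y`. -/
def IsWalk : Q → List (SignedArrow Q) → Q → Prop
  | x, [], y => x = y
  | x, e :: l, y => e.src = x ∧ IsWalk e.tgt l y

theorem isWalk_append {x y : Q} {l l' : List (SignedArrow Q)} :
    IsWalk x (l ++ l') y ↔ ∃ z, IsWalk x l z ∧ IsWalk z l' y := by
  induction l generalizing x with
  | nil => simp [IsWalk]
  | cons e l ih => simp [IsWalk, ih, and_assoc]

/-- No arrow is followed by its inverse. -/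
def Reduced (l : List (SignedArrow Q)) : Prop := l.IsChain fun e f => f ≠ e.inv

theorem Reduced.infix {l l' : List (SignedArrow Q)} (h : Reduced l') (hl : l <:+: l') :
    Reduced l := List.IsChain.infix h hl

/-- The 1-chain of a walk. -/
noncomputable def chain (l : List (SignedArrow Q)) : Quiver.Total Q →₀ ℤ :=
  (l.map fun e => Finsupp.single e.2 (if e.1 then 1 else -1)).sum

@[simp] theorem chain_cons (e : SignedArrow Q) (l : List (SignedArrow Q)) :
    chain (e :: l) = Finsupp.single e.2 (if e.1 then 1 else -1) + chain l := by simp [chain]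

theorem chain_append (l l' : List (SignedArrow Q)) : chain (l ++ l') = chain l + chain l' := by
  simp [chain]

theorem boundary_chain {x y : Q} {l : List (SignedArrow Q)} (h : IsWalk x l y) :
    quiverBoundary Q (chain l) = Finsupp.single y 1 - Finsupp.single x 1 := by
  induction l generalizing x with
  | nil => obtain rfl : x = y := h; simp [chain]
  | cons e l ih =>
    obtain ⟨rfl, h⟩ := h
    rw [chain_cons, map_add, ih h]
    rcases e with ⟨_ | _, a⟩ <;> simp [quiverBoundary, src, tgt]

theorem chain_mem {x : Q} {l : List (SignedArrow Q)} (h : IsWalk x l x) :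
    chain l ∈ quiverH1 Q := by
  simp [LinearMap.mem_ker, boundary_chain h]

theorem chain_apply_eq_zero {l : List (SignedArrow Q)} {a : Quiver.Total Q}
    (h : ∀ e ∈ l, e.2 ≠ a) : chain l a = 0 := by
  classical
  induction l with
  | nil => simp [chain]
  | cons e l ih =>
    simp only [List.mem_cons, forall_eq_or_imp] at h
    simp [ih h.2, h.1]

/-- No arrow is repeated, so nothing cancels and the coefficient is `±1`. -/
theorem chain_apply_ne_zero {l : List (SignedArrow Q)} (hl : l.Pairwise fun e f => e.2 ≠ f.2)
    {e : SignedArrow Q} (he : e ∈ l) : chain l e.2 ≠ 0 := by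
  classical
  induction l with
  | nil => simp at he
  | cons f l ih =>
    rw [List.pairwise_cons] at hl
    rcases List.mem_cons.1 he with rfl | he
    · rw [chain_cons, Finsupp.add_apply, chain_apply_eq_zero fun f hf => (hl.1 f hf).symm]
      rcases e with ⟨_ | _, a⟩ <;> simp
    · rw [chain_cons, Finsupp.add_apply, Finsupp.single_eq_of_ne (hl.1 e he).symm, zero_add]
      exact ih hl.2 he

/-- The segment between two visits to one vertex is closed. The strict drop in length drives the
reduction to simple closed walks. -/
theorem exists_closed_infix {x y : Q} {l : List (SignedArrow Q)} (h : IsWalk x l y)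
    (hl : ¬ l.Pairwise fun e f => e.src ≠ f.src) :
    ∃ v l', l' ≠ [] ∧ IsWalk v l' v ∧ l' <:+: l ∧ l'.length < l.length := by
  induction l generalizing x with
  | nil => simp at hl
  | cons e l ih =>
    obtain ⟨rfl, h⟩ := h
    rw [List.pairwise_cons, not_and_or] at hl
    rcases hl with hl | hl
    · push Not at hl
      obtain ⟨f, hf, hef⟩ := hl
      obtain ⟨l₁, l₂, rfl⟩ := List.append_of_mem hf
      obtain ⟨z, h₁, h₂, -⟩ := isWalk_append.1 h
      refine ⟨e.src, e :: l₁, by simp, ⟨rfl, ?_⟩, ⟨[], f :: l₂, by simp⟩, by simp⟩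
      rwa [hef, h₂]
    · obtain ⟨v, l', h₁, h₂, h₃, h₄⟩ := ih h hl
      exact ⟨v, l', h₁, h₂, h₃.trans (List.suffix_cons e l).isInfix, by simp; omega⟩

theorem exists_simple_closed_infix {x : Q} {l : List (SignedArrow Q)} (h : IsWalk x l x)
    (h0 : l ≠ []) : ∃ v l', l' ≠ [] ∧ IsWalk v l' v ∧ l' <:+: l ∧
      l'.Pairwise fun e f => e.src ≠ f.src := by
  induction hn : l.length using Nat.strong_induction_on generalizing x l with
  | _ n ih =>
    by_cases hl : l.Pairwise fun e f => e.src ≠ f.src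
    · exact ⟨x, l, h0, h, List.infix_rfl, hl⟩
    · obtain ⟨v, l', h₁, h₂, h₃, h₄⟩ := exists_closed_infix h hl
      obtain ⟨w, l'', k₁, k₂, k₃, k₄⟩ := ih _ (hn ▸ h₄) h₂ h₁ rfl
      exact ⟨w, l'', k₁, k₂, k₃.trans h₃, k₄⟩

/-- An arrow repeated in the same direction repeats its source. If `e` is followed later by `e.inv`,
the latter starts at `e.tgt`, as does the successor of `e`; distinct sources make them the same
step, which is a backtrack. -/
theorem pairwise_snd_ne {x y : Q} {l : List (SignedArrow Q)} (h : IsWalk x l y) (hr : Reduced l)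
    (hl : l.Pairwise fun e f => e.src ≠ f.src) : l.Pairwise fun e f => e.2 ≠ f.2 := by
  induction l generalizing x with
  | nil => simp
  | cons e l ih =>
    obtain ⟨rfl, h⟩ := h
    rw [List.pairwise_cons] at hl ⊢
    refine ⟨fun f hf hef => ?_, ih h (hr.infix (List.suffix_cons e l).isInfix) hl.2⟩
    rcases eq_or_eq_inv hef with rfl | rfl
    · exact hl.1 _ hf rfl
    · cases l with
      | nil => simp at hf
      | cons g l =>
        obtain ⟨hg, -⟩ := h
        rw [tgt_inv] at hg
        rcases List.mem_cons.1 hf with rfl | hf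
        · exact (List.isChain_cons_cons.1 hr).1 (inv_inv _).symm
        · exact (List.pairwise_cons.1 hl.2).1 f hf hg

/-- The bridge from walks to homology: a simple closed segment of a reduced walk uses each arrow at
most once, so its chain is a nonzero 1-cycle. -/
theorem Reduced.exists_cycle {x : Q} {l : List (SignedArrow Q)} (hr : Reduced l)
    (h : IsWalk x l x) (h0 : l ≠ []) : ∃ v l', l' ≠ [] ∧ IsWalk v l' v ∧ l' <:+: l ∧
      ∀ e ∈ l', chain l' e.2 ≠ 0 := by
  obtain ⟨v, l', h₁, h₂, h₃, h₄⟩ := exists_simple_closed_infix h h0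
  exact ⟨v, l', h₁, h₂, h₃, fun e he =>
    chain_apply_ne_zero (pairwise_snd_ne h₂ (hr.infix h₃) h₄) he⟩

/-! ### The core of a pseudotree -/

/-- The arrows on the cycle: those with nonzero coefficient in some 1-cycle. -/
def IsCore (a : Quiver.Total Q) : Prop := ∃ z ∈ quiverH1 Q, z a ≠ 0

/-- The vertices on the cycle. -/
def IsCoreVertex (x : Q) : Prop := ∃ e : SignedArrow Q, IsCore e.2 ∧ e.src = x

/-- Two nonzero cycles, one vanishing at `a` and the other not, would be linearly independent. -/
theorem eq_zero_of_finrank_le_one [Finite Q] [∀ i j : Q, Finite (i ⟶ j)]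
    (hQ : Module.finrank ℤ (quiverH1 Q) ≤ 1) {z w : Quiver.Total Q →₀ ℤ} (hz : z ∈ quiverH1 Q)
    (hw : w ∈ quiverH1 Q) {a : Quiver.Total Q} (hza : z a ≠ 0) (hwa : w a = 0) : w = 0 := by
  by_contra hw0
  have hli : LinearIndependent ℤ ![(⟨z, hz⟩ : quiverH1 Q), ⟨w, hw⟩] := by
    rw [LinearIndependent.pair_iff]
    intro s t hst
    have hst' : s • z + t • w = 0 := congrArg Subtype.val hst
    have hs : s = 0 := by
      have := DFunLike.congr_fun hst' a
      simpa [hwa, hza] using this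
    subst hs
    simpa [hw0] using hst'
  have := hli.fintype_card_le_finrank
  simp at this
  omega

theorem exists_first {p : SignedArrow Q → Prop} {l : List (SignedArrow Q)}
    (h : ∃ e ∈ l, p e) : ∃ l₁ e l₂, l = l₁ ++ e :: l₂ ∧ p e ∧ ∀ f ∈ l₁, ¬ p f := by
  classical
  induction l with
  | nil => simp at h
  | cons e l ih =>
    by_cases he : p e
    · exact ⟨[], e, l, rfl, he, by simp⟩
    · obtain ⟨l₁, f, l₂, rfl, h₁, h₂⟩ := ih (by simpa [he] using h)
      exact ⟨e :: l₁, f, l₂, rfl, h₁, by simpa [he] using h₂⟩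

section Pseudotree

variable [Finite Q] [∀ i j : Q, Finite (i ⟶ j)]

/-- Deleting one core arrow leaves a forest, which has no nonempty reduced closed walks. -/
theorem Reduced.eq_nil_of_avoids (hQ : Module.finrank ℤ (quiverH1 Q) ≤ 1)
    {a : Quiver.Total Q} (ha : IsCore a) {x : Q} {l : List (SignedArrow Q)} (hr : Reduced l)
    (h : IsWalk x l x) (hl : ∀ e ∈ l, e.2 ≠ a) : l = [] := by
  by_contra h0
  obtain ⟨v, l', h₁, h₂, h₃, h₄⟩ := hr.exists_cycle h h0
  obtain ⟨z, hz, hza⟩ := ha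
  have h5 : chain l' = 0 := eq_zero_of_finrank_le_one hQ hz (chain_mem h₂) hza
    (chain_apply_eq_zero fun e he => hl e (h₃.subset he))
  obtain ⟨e, he⟩ := List.exists_mem_of_ne_nil _ h₁
  exact h₄ e he (by simp [h5])

/-- A reduced closed walk based at the source of an arrow of the cycle uses that arrow at its
beginning or at its end. -/
theorem Reduced.starts_or_ends (hQ : Module.finrank ℤ (quiverH1 Q) ≤ 1) {e : SignedArrow Q}
    (he : IsCore e.2) {l : List (SignedArrow Q)} (hr : Reduced l) (h : IsWalk e.src l e.src)
    (h0 : l ≠ []) : (∃ l', l = e :: l') ∨ ∃ l', l = l' ++ [e.inv] := by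
  induction hn : l.length using Nat.strong_induction_on generalizing l with
  | _ n ih =>
    have hu : ∃ f ∈ l, f.2 = e.2 := by
      by_contra hc
      push Not at hc
      exact h0 (hr.eq_nil_of_avoids hQ he h hc)
    obtain ⟨l₁, f, l₂, rfl, h₁, h₂⟩ := exists_first hu
    obtain ⟨z, k₁, k₂, k₃⟩ := isWalk_append.1 h
    rcases eq_or_eq_inv h₁ with rfl | rfl
    · subst k₂
      obtain rfl : l₁ = [] := Reduced.eq_nil_of_avoids hQ he
        (hr.infix (List.prefix_append _ _).isInfix) k₁ h₂
      exact Or.inl ⟨l₂, rfl⟩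
    -- If the first passage is along `e.inv`, the rest is again closed at `e.src`; it cannot begin
    -- with `e`, so by induction it is empty or ends with `e.inv`.
    · right
      rw [tgt_inv] at k₃
      by_cases hl₂ : l₂ = []
      · exact ⟨l₁, by rw [hl₂]⟩
      · have hr₂ : Reduced (e.inv :: l₂) := hr.infix (List.suffix_append _ _).isInfix
        rcases ih l₂.length (by subst hn; simp; omega)
          (hr₂.infix (List.suffix_cons _ _).isInfix) k₃ hl₂ rfl with ⟨l', rfl⟩ | ⟨l', rfl⟩
        · exact absurd (inv_inv e).symm (List.isChain_cons_cons.1 hr₂).1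
        · exact ⟨l₁ ++ e.inv :: l', by simp⟩

/-- If there is a reduced closed walk, the cycle is connected. -/
theorem exists_core_walk (hQ : Module.finrank ℤ (quiverH1 Q) ≤ 1) {x : Q}
    {l : List (SignedArrow Q)} (hr : Reduced l) (h : IsWalk x l x) (h0 : l ≠ []) {c d : Q}
    (hc : IsCoreVertex c) (hd : IsCoreVertex d) :
    ∃ g, IsWalk c g d ∧ ∀ e ∈ g, IsCore e.2 := by
  obtain ⟨v, w, h₁, h₂, -, h₄⟩ := hr.exists_cycle h h0
  have hcore : ∀ e ∈ w, IsCore e.2 := fun e he => ⟨_, chain_mem h₂, h₄ e he⟩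
  -- One closed walk `w` covers the whole core: its nonzero chain would otherwise vanish at a core
  -- arrow.
  have hmem : ∀ a, IsCore a → ∃ e ∈ w, e.2 = a := by
    rintro a ⟨z, hz, hza⟩
    by_contra hc
    push Not at hc
    have h5 := eq_zero_of_finrank_le_one hQ hz (chain_mem h₂) hza (chain_apply_eq_zero hc)
    obtain ⟨e, he⟩ := List.exists_mem_of_ne_nil _ h₁
    exact h₄ e he (by simp [h5])
  have key : ∀ c, IsCoreVertex c → (∃ g, IsWalk v g c ∧ ∀ e ∈ g, IsCore e.2) ∧
      ∃ g, IsWalk c g v ∧ ∀ e ∈ g, IsCore e.2 := by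
    rintro c ⟨e, he, rfl⟩
    obtain ⟨f, hf, hfe⟩ := hmem _ he
    obtain ⟨l₁, l₂, rfl⟩ := List.append_of_mem hf
    obtain ⟨z, k₁, rfl, k₃⟩ := isWalk_append.1 h₂
    simp only [List.mem_append, List.mem_cons] at hcore
    rcases eq_or_eq_inv hfe with rfl | rfl
    · exact ⟨⟨l₁, k₁, fun e he => hcore e (Or.inl he)⟩, ⟨f :: l₂, ⟨rfl, k₃⟩, fun e he =>
        hcore e (Or.inr (List.mem_cons.1 he))⟩⟩
    · rw [tgt_inv] at k₃
      refine ⟨⟨l₁ ++ [e.inv], isWalk_append.2 ⟨_, k₁, rfl, by simp [IsWalk]⟩, fun f hf => ?_⟩,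
        ⟨l₂, k₃, fun e he => hcore e (Or.inr (Or.inr he))⟩⟩
      rcases List.mem_append.1 hf with hf | hf
      · exact hcore f (Or.inl hf)
      · exact hcore f (Or.inr (Or.inl (List.mem_singleton.1 hf)))
  obtain ⟨-, g₁, k₁, m₁⟩ := key c hc
  obtain ⟨⟨g₂, k₂, m₂⟩, -⟩ := key d hd
  exact ⟨g₁ ++ g₂, isWalk_append.2 ⟨v, k₁, k₂⟩, fun e he =>
    (List.mem_append.1 he).elim (m₁ e) (m₂ e)⟩

/-- Reduced walks between vertices of the cycle stay in the cycle. -/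
theorem Reduced.isCore_of_mem (hQ : Module.finrank ℤ (quiverH1 Q) ≤ 1)
    (hcyc : ∃ (x : Q) (l : List (SignedArrow Q)), Reduced l ∧ IsWalk x l x ∧ l ≠ []) {c d : Q}
    (hc : IsCoreVertex c) (hd : IsCoreVertex d) {l : List (SignedArrow Q)} (hr : Reduced l)
    (h : IsWalk c l d) : ∀ e ∈ l, IsCore e.2 := by
  have key : ∀ {c d : Q} {l : List (SignedArrow Q)}, IsCoreVertex c → IsCoreVertex d →
      Reduced l → IsWalk c l d → (∀ e ∈ l, ¬ IsCore e.2) → l = [] := by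
    intro c d l hc hd hr h hl
    obtain ⟨x, w, hw₁, hw₂, hw₃⟩ := hcyc
    obtain ⟨g, hg, hgc⟩ := exists_core_walk hQ hw₁ hw₂ hw₃ hd hc
    -- Closing `l` by the core walk `g` gives a 1-cycle. At an arrow outside the core this cycle
    -- vanishes and `g` contributes nothing; at a core arrow `l` contributes nothing.
    have h0 : chain l = 0 := by
      ext b
      by_cases hb : IsCore b
      · exact chain_apply_eq_zero fun e he (h : e.2 = b) => hl e he (h ▸ hb)
      · have h1 : chain (l ++ g) b = 0 := by
          by_contra hne
          exact hb ⟨_, chain_mem (isWalk_append.2 ⟨d, h, hg⟩), hne⟩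
        rwa [chain_append, Finsupp.add_apply,
          chain_apply_eq_zero (l := g) fun e he (h : e.2 = b) => hb (h ▸ hgc e he), add_zero] at h1
    have h1 := boundary_chain h
    rw [h0, map_zero] at h1
    obtain rfl : d = c := Finsupp.single_left_injective one_ne_zero (sub_eq_zero.1 h1.symm)
    obtain ⟨e, he, -⟩ := hc
    exact hr.eq_nil_of_avoids hQ he h fun f hf h => hl f hf (h ▸ he)
  induction hn : l.length using Nat.strong_induction_on generalizing l c with
  | _ n ih =>
    by_cases hu : ∃ e ∈ l, IsCore e.2
    · obtain ⟨l₁, f, l₂, rfl, h₁, h₂⟩ := exists_first hu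
      obtain ⟨z, k₁, rfl, k₃⟩ := isWalk_append.1 h
      obtain rfl := key hc ⟨f, h₁, rfl⟩ (hr.infix (List.prefix_append _ _).isInfix) k₁ h₂
      have := ih l₂.length (by subst hn; simp) ⟨f.inv, h₁, src_inv f⟩
        (hr.infix (List.suffix_cons _ _).isInfix) k₃ rfl
      simpa [h₁] using this
    · push Not at hu
      simp [key hc hd hr h hu]

end Pseudotree

end SignedArrow

/-! ### The points of a representation -/

namespace F1Rep

open SignedArrow

variable {Q : Type u} [Quiver.{v} Q]

/-- The nonzero elements of a representation at a vertex. -/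
abbrev PointAt (M : F1Rep Q) (i : Q) := {x : (M.obj i).carrier // x ≠ (M.obj i).zero}

/-- The nonzero elements of a representation: the vertices of its coefficient quiver. -/
abbrev Point (M : F1Rep Q) := Σ i, M.PointAt i

/-- The arrows of the coefficient quiver. -/
inductive Arr (M : F1Rep Q) : Quiver.Total Q → M.Point → M.Point → Prop
  | mk {i j : Q} (α : i ⟶ j) (x : M.PointAt i) (y : M.PointAt j) (h : M.map α x.1 = y.1) :
    Arr M ⟨i, j, α⟩ ⟨i, x⟩ ⟨j, y⟩

/-- A step along a signed arrow. -/
def Step (M : F1Rep Q) (e : SignedArrow Q) (p q : M.Point) : Prop :=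
  if e.1 then M.Arr e.2 p q else M.Arr e.2 q p

theorem arr_mk_iff {M : F1Rep Q} {i j : Q} {α : i ⟶ j} {x : M.PointAt i} {y : M.PointAt j} :
    M.Arr ⟨i, j, α⟩ ⟨i, x⟩ ⟨j, y⟩ ↔ M.map α x.1 = y.1 :=
  ⟨fun h => by cases h; assumption, Arr.mk α x y⟩

theorem Arr.functional {M : F1Rep Q} {a : Quiver.Total Q} {p q q' : M.Point} (h : M.Arr a p q)
    (h' : M.Arr a p q') : q = q' := by
  cases h with
  | mk α x y h =>
    cases h' with
    | mk _ _ y' h' => rw [Subtype.ext (h.symm.trans h')]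

theorem Arr.injective {M : F1Rep Q} {a : Quiver.Total Q} {p p' q : M.Point} (h : M.Arr a p q)
    (h' : M.Arr a p' q) : p = p' := by
  cases h with
  | mk α x y h =>
    cases h' with
    | mk _ x' _ h' =>
      rw [Subtype.ext ((M.map α).inj x.1 x'.1 (by rw [h]; exact y.2) (h.trans h'.symm))]

/-- Along an arrow this holds because the structure map is a function; against it, because the map
is injective away from the preimage of zero. -/
theorem Step.functional {M : F1Rep Q} {e : SignedArrow Q} {p q q' : M.Point}
    (h : M.Step e p q) (h' : M.Step e p q') : q = q' := by
  rcases e with ⟨_ | _, a⟩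
  · exact Arr.injective h h'
  · exact Arr.functional h h'

theorem step_inv {M : F1Rep Q} {e : SignedArrow Q} {p q : M.Point} :
    M.Step e.inv p q ↔ M.Step e q p := by
  rcases e with ⟨_ | _, a⟩ <;> simp [Step, SignedArrow.inv]

theorem Step.src_tgt {M : F1Rep Q} {e : SignedArrow Q} {p q : M.Point} (h : M.Step e p q) :
    e.src = p.1 ∧ e.tgt = q.1 := by
  rcases e with ⟨_ | _, a⟩ <;> simp only [Step] at h <;> cases h <;> exact ⟨rfl, rfl⟩

/-- A walk in the coefficient quiver. -/
def Lift (M : F1Rep Q) : M.Point → List (SignedArrow Q) → M.Point → Prop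
  | p, [], q => p = q
  | p, e :: l, q => ∃ r, M.Step e p r ∧ Lift M r l q

theorem lift_append {M : F1Rep Q} {p q : M.Point} {l l' : List (SignedArrow Q)} :
    M.Lift p (l ++ l') q ↔ ∃ r, M.Lift p l r ∧ M.Lift r l' q := by
  induction l generalizing p with
  | nil => simp [Lift]
  | cons e l ih => simp only [List.cons_append, Lift, ih]; grind

theorem Lift.isWalk {M : F1Rep Q} {p q : M.Point} {l : List (SignedArrow Q)}
    (h : M.Lift p l q) : IsWalk p.1 l q.1 := by
  induction l generalizing p with
  | nil => exact congrArg Sigma.fst h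
  | cons e l ih =>
    obtain ⟨r, h₁, h₂⟩ := h
    exact ⟨h₁.src_tgt.1, h₁.src_tgt.2 ▸ ih h₂⟩

theorem Lift.exists_of_mem {M : F1Rep Q} {p q : M.Point} {l : List (SignedArrow Q)}
    (h : M.Lift p l q) {e : SignedArrow Q} (he : e ∈ l) : ∃ r : M.Point, e.src = r.1 := by
  obtain ⟨l₁, l₂, rfl⟩ := List.append_of_mem he
  obtain ⟨r, -, r', h, -⟩ := lift_append.1 h
  exact ⟨r, h.src_tgt.1⟩

theorem Lift.exists_reverse {M : F1Rep Q} {p q : M.Point} {l : List (SignedArrow Q)}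
    (h : M.Lift p l q) : ∃ l', M.Lift q l' p := by
  induction l generalizing p with
  | nil => exact ⟨[], Eq.symm h⟩
  | cons e l ih =>
    obtain ⟨r, h₁, h₂⟩ := h
    obtain ⟨l', h₃⟩ := ih h₂
    exact ⟨l' ++ [e.inv], lift_append.2 ⟨r, h₃, p, step_inv.2 h₁, rfl⟩⟩

/-- The coefficient quiver is nonempty and connected. -/
def IsConnected (M : F1Rep Q) : Prop :=
  Nonempty M.Point ∧ ∀ p q : M.Point, ∃ l, M.Lift p l q

/-- By uniqueness of lifts a backtrack `e`, `e.inv` returns to the same point, so deleting it leaves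
a lifted walk. -/
theorem IsConnected.exists_reduced {M : F1Rep Q} (hM : M.IsConnected) (p q : M.Point) :
    ∃ l, Reduced l ∧ M.Lift p l q := by
  obtain ⟨l, hl⟩ := hM.2 p q
  induction hn : l.length using Nat.strong_induction_on generalizing l with
  | _ n ih =>
    by_cases hr : Reduced l
    · exact ⟨l, hr, hl⟩
    · have : ∃ l₁ e l₂, l = l₁ ++ e :: e.inv :: l₂ := by
        clear ih hl hn
        induction l with
        | nil => exact absurd List.IsChain.nil hr
        | cons e l ih =>
          by_cases hr' : Reduced l
          · cases l with
            | nil => exact absurd (List.IsChain.singleton e) hr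
            | cons f l =>
              have : f = e.inv := by
                by_contra hf
                exact hr (List.isChain_cons_cons.2 ⟨hf, hr'⟩)
              exact ⟨[], e, l, by rw [this]; rfl⟩
          · obtain ⟨l₁, f, l₂, rfl⟩ := ih hr'
            exact ⟨e :: l₁, f, l₂, rfl⟩
      obtain ⟨l₁, e, l₂, rfl⟩ := this
      obtain ⟨r, h₁, r₁, h₂, r₂, h₃, h₄⟩ := lift_append.1 hl
      obtain rfl := h₂ |> step_inv.2 |>.functional h₃
      exact ih (l₁ ++ l₂).length (by subst hn; simp) (l₁ ++ l₂)
        (lift_append.2 ⟨r, h₁, h₄⟩) rfl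

/-- The point is not the start of a step along `e`. -/
def Misses (M : F1Rep Q) (e : SignedArrow Q) (p : M.Point) : Prop := ∀ q, ¬ M.Step e p q

theorem Misses.reduced_cons {M : F1Rep Q} {e : SignedArrow Q} {p q : M.Point}
    (he : M.Misses e.inv p) {l : List (SignedArrow Q)} (h : M.Lift p l q) (hl : Reduced l) :
    Reduced (e :: l) := by
  cases l with
  | nil => exact List.IsChain.singleton e
  | cons f l =>
    refine List.isChain_cons_cons.2 ⟨?_, hl⟩
    rintro rfl
    obtain ⟨r, h₁, -⟩ := h
    exact he r h₁

theorem Misses.reduced_concat {M : F1Rep Q} {e : SignedArrow Q} {p q : M.Point}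
    (he : M.Misses e q) {l : List (SignedArrow Q)} (h : M.Lift p l q) (hl : Reduced l) :
    Reduced (l ++ [e]) := by
  refine List.isChain_append.2 ⟨hl, List.IsChain.singleton e, ?_⟩
  intro f hf e' he'
  obtain rfl : e = e' := by simpa using he'
  obtain ⟨l', rfl⟩ := List.getLast?_eq_some_iff.1 hf
  rintro rfl
  obtain ⟨r, -, r', h₁, rfl⟩ := lift_append.1 h
  exact he r (step_inv.2 h₁)

/-- A nonempty reduced walk from `p` to `q` projects to a closed walk at `e.src`. It starts with `e`
or ends with `e.inv`, so `e` lifts from `p` or from `q`. -/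
theorem Misses.unique [Finite Q] [∀ i j : Q, Finite (i ⟶ j)]
    (hQ : Module.finrank ℤ (quiverH1 Q) ≤ 1) {M : F1Rep Q} (hM : M.IsConnected)
    {e : SignedArrow Q} (he : IsCore e.2) {p q : M.Point} (hp : M.Misses e p)
    (hq : M.Misses e q) (hp' : e.src = p.1) (hq' : e.src = q.1) : p = q := by
  obtain ⟨l, hl, h⟩ := hM.exists_reduced p q
  by_cases h0 : l = []
  · subst h0; exact h
  have hw := h.isWalk
  rw [← hp', ← hq'] at hw
  rcases hl.starts_or_ends hQ he hw h0 with ⟨l', rfl⟩ | ⟨l', rfl⟩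
  · obtain ⟨r, h, -⟩ := h
    exact absurd h (hp r)
  · obtain ⟨r, -, r', h', rfl⟩ := lift_append.1 h
    exact absurd (step_inv.1 h') (hq r)

/-- The representation meets the cycle. -/
def MeetsCore (M : F1Rep Q) : Prop := ∃ p : M.Point, IsCoreVertex p.1

theorem dim_eq_card [Fintype Q] (M : F1Rep Q) : M.dim = Nat.card M.Point := by
  rw [Nat.card_sigma]; rfl

/-- Pigeonhole: more points than vertices of `Q` puts two distinct points over one vertex. -/
theorem IsConnected.exists_reduced_closed [Fintype Q] {M : F1Rep Q} (hM : M.IsConnected)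
    (hd : Fintype.card Q < M.dim) :
    ∃ (p q : M.Point) (l : List (SignedArrow Q)), p.1 = q.1 ∧ Reduced l ∧ M.Lift p l q ∧
      l ≠ [] := by
  have : ¬ Function.Injective fun p : M.Point => p.1 := by
    intro hi
    have := Nat.card_le_card_of_injective _ hi
    rw [← dim_eq_card, Nat.card_eq_fintype_card] at this
    omega
  simp only [Function.Injective, not_forall] at this
  obtain ⟨p, q, hpq, hne⟩ := this
  obtain ⟨l, hl, h⟩ := hM.exists_reduced p q
  refine ⟨p, q, l, hpq, hl, h, ?_⟩
  rintro rfl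
  exact hne h

theorem IsConnected.meetsCore [Fintype Q]
    {M : F1Rep Q} (hM : M.IsConnected) (hd : Fintype.card Q < M.dim) : M.MeetsCore := by
  obtain ⟨p, q, l, hpq, hl, h, h0⟩ := hM.exists_reduced_closed hd
  have hw := h.isWalk
  rw [← hpq] at hw
  obtain ⟨v, w, h₁, h₂, h₃, h₄⟩ := hl.exists_cycle hw h0
  obtain ⟨e, he⟩ := List.exists_mem_of_ne_nil _ h₁
  obtain ⟨r, hr⟩ := h.exists_of_mem (h₃.subset he)
  exact ⟨r, e, ⟨_, chain_mem h₂, h₄ e he⟩, hr⟩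

/-! ### Isomorphisms and indecomposability -/

theorem _root_.F1RepHom.naturality_apply {M N : F1Rep Q} (f : F1RepHom M N) {i j : Q} (α : i ⟶ j)
    (x : (M.obj i).carrier) : f.app j (M.map α x) = N.map α (f.app i x) :=
  congrFun (congrArg F1Hom.toFun (f.naturality α)) x

theorem nonempty_iso_of_bijective {M N : F1Rep Q} (f : F1RepHom M N)
    (hf : ∀ i, Function.Bijective (f.app i)) : Nonempty (M ≅ N) := by
  let e := fun i => Equiv.ofBijective _ (hf i)
  have he : ∀ i x, e i x = f.app i x := fun _ _ => rfl
  refine ⟨⟨f, ⟨fun i => ⟨(e i).symm, ?_, fun x y _ h => (e i).symm.injective h⟩, ?_⟩, ?_, ?_⟩⟩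
  · rw [Equiv.symm_apply_eq, he, (f.app i).map_zero]
  · intro i j α
    apply F1Hom.ext
    funext x
    change (e j).symm (N.map α x) = M.map α ((e i).symm x)
    rw [Equiv.symm_apply_eq, he, f.naturality_apply, ← he, Equiv.apply_symm_apply]
  · exact F1RepHom.ext <| funext fun i => F1Hom.ext <| funext fun x =>
      (e i).symm_apply_apply x
  · exact F1RepHom.ext <| funext fun i => F1Hom.ext <| funext fun x =>
      (e i).apply_symm_apply x

theorem iso_hom_inv_apply {M N : F1Rep Q} (e : M ≅ N) (i : Q) (x : (N.obj i).carrier) :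
    F1RepHom.app e.hom i (F1RepHom.app e.inv i x) = x :=
  congrFun (congrArg F1Hom.toFun (congrFun (congrArg F1RepHom.app e.inv_hom_id) i)) x

theorem iso_inv_hom_apply {M N : F1Rep Q} (e : M ≅ N) (i : Q) (x : (M.obj i).carrier) :
    F1RepHom.app e.inv i (F1RepHom.app e.hom i x) = x :=
  congrFun (congrArg F1Hom.toFun (congrFun (congrArg F1RepHom.app e.hom_inv_id) i)) x

theorem nonempty_iso_of_points {M N : F1Rep Q} (φ : ∀ i, M.PointAt i ≃ N.PointAt i)
    (h : ∀ {i j} (α : i ⟶ j) (x : M.PointAt i) (y : M.PointAt j),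
      M.map α x.1 = y.1 ↔ N.map α (φ i x).1 = (φ j y).1) : Nonempty (M ≅ N) := by
  classical
  let F : ∀ i, (M.obj i).carrier → (N.obj i).carrier := fun i x =>
    if hx : x = (M.obj i).zero then (N.obj i).zero else (φ i ⟨x, hx⟩).1
  have F0 : ∀ i, F i (M.obj i).zero = (N.obj i).zero := fun i => dif_pos rfl
  have F1 : ∀ i (x : M.PointAt i), F i x.1 = (φ i x).1 := fun i x => dif_neg x.2
  have Finj : ∀ i, Function.Injective (F i) := by
    intro i x y hxy
    by_cases hx : x = (M.obj i).zero <;> by_cases hy : y = (M.obj i).zero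
    · rw [hx, hy]
    · rw [hx, F0, F1 i ⟨y, hy⟩] at hxy
      exact absurd hxy.symm (φ i ⟨y, hy⟩).2
    · rw [hy, F0, F1 i ⟨x, hx⟩] at hxy
      exact absurd hxy (φ i ⟨x, hx⟩).2
    · rw [F1 i ⟨x, hx⟩, F1 i ⟨y, hy⟩] at hxy
      exact congrArg Subtype.val ((φ i).injective (Subtype.ext hxy))
  have Fsurj : ∀ i, Function.Surjective (F i) := by
    intro i y
    by_cases hy : y = (N.obj i).zero
    · exact ⟨_, (F0 i).trans hy.symm⟩
    · exact ⟨((φ i).symm ⟨y, hy⟩).1, by rw [F1, Equiv.apply_symm_apply]⟩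
  refine nonempty_iso_of_bijective ⟨fun i => ⟨F i, F0 i, fun x y _ h => Finj i h⟩, ?_⟩
    fun i => ⟨Finj i, Fsurj i⟩
  intro i j α
  apply F1Hom.ext
  funext x
  change F j (M.map α x) = N.map α (F i x)
  by_cases hx : x = (M.obj i).zero
  · rw [hx, F0, (M.map α).map_zero, F0, (N.map α).map_zero]
  rw [F1 i ⟨x, hx⟩]
  -- A nonzero value in `N` would pull back through `φ j` to a nonzero value in `M`.
  by_cases hy : M.map α x = (M.obj j).zero
  · rw [hy, F0]
    by_contra hne
    have h1 := (h α ⟨x, hx⟩ ((φ j).symm ⟨_, fun h => hne h.symm⟩)).2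
      (by rw [Equiv.apply_symm_apply])
    exact ((φ j).symm _).2 (h1.symm.trans hy)
  · rw [F1 j ⟨_, hy⟩, (h α ⟨x, hx⟩ ⟨_, hy⟩).1 rfl]

/-- The subrepresentation on a set of points closed under the arrows. -/
def restrict (M : F1Rep Q) (S : ∀ i, (M.obj i).carrier → Prop)
    (hS : ∀ {i j} (α : i ⟶ j) x, S i x → S j (M.map α x)) (h0 : ∀ i, S i (M.obj i).zero) :
    F1Rep Q where
  obj i := ⟨{x // S i x}, ⟨_, h0 i⟩, inferInstance⟩
  map α := ⟨fun x => ⟨M.map α x.1, hS α x.1 x.2⟩, Subtype.ext (M.map α).map_zero,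
    fun x y hx h => Subtype.ext ((M.map α).inj x.1 y.1 (fun h => hx (Subtype.ext h))
      (congrArg Subtype.val h))⟩

/-- The connected component of a point and its complement, each with the zeros added, are
subrepresentations whose direct sum is `M`. -/
theorem Indecomposable.isConnected {M : F1Rep Q} (hM : M.Indecomposable) : M.IsConnected := by
  classical
  obtain ⟨hz, hd⟩ := hM
  refine ⟨?_, fun p q => ?_⟩
  · simp only [IsZero, not_forall] at hz
    obtain ⟨i, x, hx⟩ := hz
    exact ⟨⟨i, x, hx⟩⟩
  by_contra hpq
  let C : ∀ i, (M.obj i).carrier → Prop := fun i x => ∃ h, ∃ l, M.Lift p l ⟨i, x, h⟩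
  let S : ∀ i, (M.obj i).carrier → Prop := fun i x => x = (M.obj i).zero ∨ C i x
  let T : ∀ i, (M.obj i).carrier → Prop := fun i x => x = (M.obj i).zero ∨ ¬ C i x
  have hstep : ∀ {i j : Q} (α : i ⟶ j) x, M.map α x ≠ (M.obj j).zero →
      (C i x ↔ C j (M.map α x)) := by
    intro i j α x hy
    have hx : x ≠ (M.obj i).zero := fun h => hy (by rw [h, (M.map α).map_zero])
    have ha : M.Step (true, ⟨i, j, α⟩) ⟨i, x, hx⟩ ⟨j, _, hy⟩ := Arr.mk α _ _ rfl
    constructor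
    · rintro ⟨h, l, hl⟩
      exact ⟨hy, l ++ [_], lift_append.2 ⟨_, hl, _, ha, rfl⟩⟩
    · rintro ⟨h, l, hl⟩
      exact ⟨hx, l ++ [_], lift_append.2 ⟨_, hl, _, step_inv.2 ha, rfl⟩⟩
  have hS : ∀ {i j : Q} (α : i ⟶ j) x, S i x → S j (M.map α x) := by
    intro i j α x hx
    by_cases hy : M.map α x = (M.obj j).zero
    · exact Or.inl hy
    · rcases hx with rfl | hx
      · exact absurd (M.map α).map_zero hy
      · exact Or.inr ((hstep α x hy).1 hx)
  have hT : ∀ {i j : Q} (α : i ⟶ j) x, T i x → T j (M.map α x) := by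
    intro i j α x hx
    by_cases hy : M.map α x = (M.obj j).zero
    · exact Or.inl hy
    · rcases hx with rfl | hx
      · exact absurd (M.map α).map_zero hy
      · exact Or.inr (mt (hstep α x hy).2 hx)
  have hC0 : ∀ i, ¬ C i (M.obj i).zero := fun i ⟨h, _⟩ => h rfl
  let A := M.restrict S hS fun i => Or.inl rfl
  let B := M.restrict T hT fun i => Or.inl rfl
  let F : ∀ i, (M.obj i).carrier → ((A.sum B).obj i).carrier := fun i x =>
    if h : C i x then ⟨(⟨x, Or.inr h⟩, ⟨_, Or.inl rfl⟩), Or.inr rfl⟩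
    else ⟨(⟨_, Or.inl rfl⟩, ⟨x, Or.inr h⟩), Or.inl rfl⟩
  have Fpos : ∀ i x (h : C i x),
      F i x = ⟨(⟨x, Or.inr h⟩, ⟨_, Or.inl rfl⟩), Or.inr rfl⟩ := fun i x h => dif_pos h
  have Fneg : ∀ i x (h : ¬ C i x),
      F i x = ⟨(⟨_, Or.inl rfl⟩, ⟨x, Or.inr h⟩), Or.inl rfl⟩ := fun i x h => dif_neg h
  have hiso : Nonempty (M ≅ A.sum B) := by
    have Finj : ∀ i, Function.Injective (F i) := by
      intro i x y h
      by_cases hx : C i x <;> by_cases hy : C i y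
      · rw [Fpos i x hx, Fpos i y hy] at h
        exact congrArg (fun z => z.1.1.1) h
      · rw [Fpos i x hx, Fneg i y hy] at h
        have : x = (M.obj i).zero := congrArg (fun z => z.1.1.1) h
        exact absurd (this ▸ hx) (hC0 i)
      · rw [Fneg i x hx, Fpos i y hy] at h
        have : (M.obj i).zero = y := congrArg (fun z => z.1.1.1) h
        exact absurd (this ▸ hy) (hC0 i)
      · rw [Fneg i x hx, Fneg i y hy] at h
        exact congrArg (fun z => z.1.2.1) h
    refine nonempty_iso_of_bijective
      ⟨fun i => ⟨F i, Fneg i _ (hC0 i), fun x y _ h => Finj i h⟩, ?_⟩ fun i => ⟨Finj i, ?_⟩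
    · intro i j α
      apply F1Hom.ext
      funext x
      change F j (M.map α x) = (A.sum B).map α (F i x)
      by_cases hy : M.map α x = (M.obj j).zero
      · rw [hy, Fneg _ _ (hC0 j)]
        by_cases hx : C i x
        · rw [Fpos i x hx]
          exact Subtype.ext (Prod.ext (Subtype.ext hy.symm) (Subtype.ext (M.map α).map_zero.symm))
        · rw [Fneg i x hx]
          exact Subtype.ext (Prod.ext (Subtype.ext (M.map α).map_zero.symm) (Subtype.ext hy.symm))
      · by_cases hx : C i x
        · rw [Fpos i x hx, Fpos j _ ((hstep α x hy).1 hx)]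
          exact Subtype.ext (Prod.ext rfl (Subtype.ext (M.map α).map_zero.symm))
        · rw [Fneg i x hx, Fneg j _ (mt (hstep α x hy).2 hx)]
          exact Subtype.ext (Prod.ext (Subtype.ext (M.map α).map_zero.symm) rfl)
    · rintro ⟨⟨⟨x, hx⟩, ⟨y, hy⟩⟩, h⟩
      by_cases hxC : C i x
      · refine ⟨x, (Fpos i x hxC).trans (Subtype.ext (Prod.ext rfl (h.resolve_left ?_).symm))⟩
        intro h
        have : x = (M.obj i).zero := congrArg Subtype.val h
        exact hC0 i (this ▸ hxC)
      · obtain rfl := hx.resolve_right hxC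
        have hyC : ¬ C i y := by
          rcases hy with rfl | hy
          · exact hC0 i
          · exact hy
        exact ⟨y, Fneg i y hyC⟩
  rcases hd A B hiso with h | h
  · exact p.2.2 (congrArg Subtype.val (h p.1 ⟨p.2.1, Or.inr ⟨p.2.2, [], rfl⟩⟩))
  · exact q.2.2 (congrArg Subtype.val (h q.1 ⟨q.2.1, Or.inr fun ⟨_, h⟩ => hpq h⟩))

theorem IsConnected.indecomposable {M : F1Rep Q} (hM : M.IsConnected) : M.Indecomposable := by
  obtain ⟨⟨i, x, hx⟩, hc⟩ := hM
  refine ⟨fun h => hx (h i x), fun A B ⟨e⟩ => ?_⟩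
  by_contra hAB
  simp only [IsZero, not_or, not_forall] at hAB
  obtain ⟨⟨i, a, ha⟩, j, b, hb⟩ := hAB
  -- Lying in the summand `A` is invariant under steps in both directions, so it is constant on a
  -- connected coefficient quiver.
  let P : M.Point → Prop := fun p => (F1RepHom.app e.hom p.1 p.2.1).1.1 ≠ (A.obj p.1).zero
  have hArr : ∀ c p q, M.Arr c p q → (P p ↔ P q) := by
    rintro _ _ _ ⟨α, ⟨x, hx⟩, ⟨y, hy⟩, h⟩
    have hn := F1RepHom.naturality_apply e.hom α x
    change M.map α x = y at h
    rw [h] at hn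
    have h1 : (F1RepHom.app e.hom _ y).1.1 = A.map α (F1RepHom.app e.hom _ x).1.1 :=
      congrArg (fun z => z.1.1) hn
    have h2 : (F1RepHom.app e.hom _ y).1.2 = B.map α (F1RepHom.app e.hom _ x).1.2 :=
      congrArg (fun z => z.1.2) hn
    have hy' : F1RepHom.app e.hom _ y ≠ ((A.sum B).obj _).zero := by
      intro h0
      apply hy
      rw [← iso_inv_hom_apply e _ y, h0, F1Hom.map_zero]
    change (F1RepHom.app e.hom _ x).1.1 ≠ _ ↔ (F1RepHom.app e.hom _ y).1.1 ≠ _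
    rw [h1]
    constructor
    · intro hp hq
      have hx2 := (F1RepHom.app e.hom _ x).2.resolve_left hp
      apply hy'
      apply Subtype.ext
      refine Prod.ext (h1.trans hq) (h2.trans ?_)
      rw [hx2]
      exact (B.map α).map_zero
    · intro hq hp
      exact hq (by rw [hp, (A.map α).map_zero])
  have hLift : ∀ l p q, M.Lift p l q → (P p ↔ P q) := by
    intro l
    induction l with
    | nil => rintro p q rfl; rfl
    | cons c l ih =>
      rintro p q ⟨r, h₁, h₂⟩
      rw [← ih r q h₂]
      rcases c with ⟨_ | _, c⟩
      · exact (hArr c _ _ h₁).symm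
      · exact hArr c _ _ h₁
  let a' : ((A.sum B).obj i).carrier := ⟨(a, (B.obj i).zero), Or.inr rfl⟩
  let b' : ((A.sum B).obj j).carrier := ⟨((A.obj j).zero, b), Or.inl rfl⟩
  have ha' : F1RepHom.app e.inv i a' ≠ (M.obj i).zero := by
    intro h
    have h1 := iso_hom_inv_apply e i a'
    rw [h, F1Hom.map_zero] at h1
    exact ha (congrArg (fun z => z.1.1) h1).symm
  have hb' : F1RepHom.app e.inv j b' ≠ (M.obj j).zero := by
    intro h
    have h1 := iso_hom_inv_apply e j b'
    rw [h, F1Hom.map_zero] at h1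
    exact hb (congrArg (fun z => z.1.2) h1).symm
  obtain ⟨l, hl⟩ := hc ⟨i, _, ha'⟩ ⟨j, _, hb'⟩
  have h1 := hLift _ _ _ hl
  simp only [P, iso_hom_inv_apply] at h1
  exact h1.1 ha rfl

theorem Indecomposable.of_iso {M N : F1Rep Q} (h : M.Indecomposable) (e : M ≅ N) :
    N.Indecomposable := by
  refine ⟨fun hN => h.1 fun i x => ?_, fun A B ⟨f⟩ => h.2 A B ⟨e.trans f⟩⟩
  rw [← iso_inv_hom_apply e i x, hN i (F1RepHom.app e.hom i x), F1Hom.map_zero]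

theorem dim_eq_of_iso [Fintype Q] {M N : F1Rep Q} (e : M ≅ N) : M.dim = N.dim := by
  refine Finset.sum_congr rfl fun i _ => Nat.card_congr
    ⟨fun x => ⟨F1RepHom.app e.hom i x.1, fun h => x.2 ?_⟩,
      fun x => ⟨F1RepHom.app e.inv i x.1, fun h => x.2 ?_⟩,
      fun x => Subtype.ext (iso_inv_hom_apply e i x.1),
      fun x => Subtype.ext (iso_hom_inv_apply e i x.1)⟩
  · rw [← iso_inv_hom_apply e i x.1, h, F1Hom.map_zero]
  · rw [← iso_hom_inv_apply e i x.1, h, F1Hom.map_zero]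

/-! ### Gluings of two representations -/

/-- The coefficient quiver of `R` is the disjoint union of those of `M` and `N` together with
arrows between the two. -/
structure Gluing (M N R : F1Rep Q) where
  equiv : ∀ i, M.PointAt i ⊕ N.PointAt i ≃ R.PointAt i
  map_inl : ∀ {i j : Q} (α : i ⟶ j) (x : M.PointAt i) (y : M.PointAt j),
    R.map α (equiv i (Sum.inl x)).1 = (equiv j (Sum.inl y)).1 ↔ M.map α x.1 = y.1
  map_inr : ∀ {i j : Q} (α : i ⟶ j) (x : N.PointAt i) (y : N.PointAt j),
    R.map α (equiv i (Sum.inr x)).1 = (equiv j (Sum.inr y)).1 ↔ N.map α x.1 = y.1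

namespace Gluing

variable {M N R R' : F1Rep Q}

def symm (G : Gluing M N R) : Gluing N M R where
  equiv i := (Equiv.sumComm _ _).trans (G.equiv i)
  map_inl := G.map_inr
  map_inr := G.map_inl

def inl (G : Gluing M N R) (p : M.Point) : R.Point := ⟨p.1, G.equiv p.1 (Sum.inl p.2)⟩

def inr (G : Gluing M N R) (p : N.Point) : R.Point := ⟨p.1, G.equiv p.1 (Sum.inr p.2)⟩

theorem inl_ne_inr (G : Gluing M N R) (p : M.Point) (q : N.Point) : G.inl p ≠ G.inr q := by
  rcases p with ⟨i, x⟩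
  rcases q with ⟨j, y⟩
  intro h
  obtain rfl : i = j := congrArg Sigma.fst h
  have := eq_of_heq (Sigma.mk.inj h).2
  simpa using (G.equiv i).injective this

theorem eq_inl_or_inr (G : Gluing M N R) (r : R.Point) :
    (∃ p, r = G.inl p) ∨ ∃ q, r = G.inr q := by
  rcases r with ⟨i, x⟩
  obtain ⟨p | p, rfl⟩ := (G.equiv i).surjective x
  · exact Or.inl ⟨⟨i, p⟩, rfl⟩
  · exact Or.inr ⟨⟨i, p⟩, rfl⟩

theorem arr_inl (G : Gluing M N R) {a : Quiver.Total Q} {p q : M.Point} (h : M.Arr a p q) :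
    R.Arr a (G.inl p) (G.inl q) := by
  obtain ⟨α, x, y, h⟩ := h
  exact Arr.mk α _ _ ((G.map_inl α x y).2 h)

theorem step_inl (G : Gluing M N R) {e : SignedArrow Q} {p q : M.Point} (h : M.Step e p q) :
    R.Step e (G.inl p) (G.inl q) := by
  rcases e with ⟨_ | _, a⟩
  · exact G.arr_inl (a := a) h
  · exact G.arr_inl (a := a) h

theorem lift_inl (G : Gluing M N R) {l : List (SignedArrow Q)} {p q : M.Point}
    (h : M.Lift p l q) : R.Lift (G.inl p) l (G.inl q) := by
  induction l generalizing p with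
  | nil => exact congrArg G.inl h
  | cons e l ih =>
    obtain ⟨r, h₁, h₂⟩ := h
    exact ⟨_, G.step_inl h₁, ih h₂⟩

/-- The connecting arrows of a gluing. -/
def Conn (G : Gluing M N R) (e : SignedArrow Q) (p : M.Point) (q : N.Point) : Prop :=
  R.Step e (G.inl p) (G.inr q)

theorem Conn.src_tgt {G : Gluing M N R} {e : SignedArrow Q} {p : M.Point} {q : N.Point}
    (h : G.Conn e p q) : e.src = p.1 ∧ e.tgt = q.1 := Step.src_tgt h

theorem conn_symm {G : Gluing M N R} {e : SignedArrow Q} {p : M.Point} {q : N.Point} :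
    G.symm.Conn e.inv q p ↔ G.Conn e p q := step_inv

/-- In `R` the step along `e` from this point is already taken by the connecting arrow, and lifts
are unique. -/
theorem Conn.misses_left {G : Gluing M N R} {e : SignedArrow Q} {p : M.Point} {q : N.Point}
    (h : G.Conn e p q) : M.Misses e p := fun r hr =>
  G.inl_ne_inr r q ((G.step_inl hr).functional h)

theorem Conn.misses_right {G : Gluing M N R} {e : SignedArrow Q} {p : M.Point} {q : N.Point}
    (h : G.Conn e p q) : N.Misses e.inv q := (conn_symm.2 h).misses_left

theorem inl_injective (G : Gluing M N R) : Function.Injective G.inl := by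
  rintro ⟨i, x⟩ ⟨j, y⟩ h
  obtain rfl : i = j := congrArg Sigma.fst h
  have := (G.equiv i).injective (eq_of_heq (Sigma.mk.inj h).2)
  exact congrArg (Sigma.mk i) (Sum.inl.inj this)

theorem Conn.left_unique {G : Gluing M N R} {e : SignedArrow Q} {p p' : M.Point} {q : N.Point}
    (h : G.Conn e p q) (h' : G.Conn e p' q) : p = p' :=
  G.inl_injective ((step_inv.2 h).functional (step_inv.2 h'))

theorem conn_true_iff {G : Gluing M N R} {i j : Q} {α : i ⟶ j} {x : M.PointAt i}
    {y : N.PointAt j} : G.Conn (true, ⟨i, j, α⟩) ⟨i, x⟩ ⟨j, y⟩ ↔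
      R.map α (G.equiv i (Sum.inl x)).1 = (G.equiv j (Sum.inr y)).1 := arr_mk_iff

theorem conn_false_iff {G : Gluing M N R} {i j : Q} {α : i ⟶ j} {x : N.PointAt i}
    {y : M.PointAt j} : G.Conn (false, ⟨i, j, α⟩) ⟨j, y⟩ ⟨i, x⟩ ↔
      R.map α (G.equiv i (Sum.inr x)).1 = (G.equiv j (Sum.inl y)).1 := arr_mk_iff

/-- A gluing is determined by its connecting arrows. -/
theorem nonempty_iso (G : Gluing M N R) (G' : Gluing M N R')
    (h : ∀ e p q, G.Conn e p q ↔ G'.Conn e p q) : Nonempty (R ≅ R') := by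
  refine nonempty_iso_of_points (fun i => (G.equiv i).symm.trans (G'.equiv i)) ?_
  intro i j α x y
  obtain ⟨x, rfl⟩ := (G.equiv i).surjective x
  obtain ⟨y, rfl⟩ := (G.equiv j).surjective y
  simp only [Equiv.trans_apply, Equiv.symm_apply_apply]
  rcases x with x | x <;> rcases y with y | y
  · rw [G.map_inl, G'.map_inl]
  · rw [← conn_true_iff, ← conn_true_iff, h]
  · rw [← conn_false_iff, ← conn_false_iff, h]
  · rw [G.map_inr, G'.map_inr]

/-- A walk in `R` from a point of `M` to a point of `N` must cross over; the first crossing is a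
connecting arrow. -/
theorem exists_conn (G : Gluing M N R) (hR : R.IsConnected) (hM : Nonempty M.Point)
    (hN : Nonempty N.Point) : ∃ e p q, G.Conn e p q := by
  obtain ⟨p⟩ := hM
  obtain ⟨q⟩ := hN
  obtain ⟨l, hl⟩ := hR.2 (G.inl p) (G.inr q)
  induction l generalizing p with
  | nil => exact absurd hl (G.inl_ne_inr p q)
  | cons e l ih =>
    obtain ⟨r, h₁, h₂⟩ := hl
    rcases G.eq_inl_or_inr r with ⟨p', rfl⟩ | ⟨q', rfl⟩
    · exact ih p' h₂
    · exact ⟨e, p, q', h₁⟩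

theorem isConnected (G : Gluing M N R) (hM : M.IsConnected) (hN : N.IsConnected)
    (hc : ∃ e p q, G.Conn e p q) : R.IsConnected := by
  obtain ⟨e, p, q, h⟩ := hc
  have hto : ∀ r, ∃ l, R.Lift (G.inl p) l r := by
    intro r
    rcases G.eq_inl_or_inr r with ⟨p', rfl⟩ | ⟨q', rfl⟩
    · obtain ⟨l, hl⟩ := hM.2 p p'
      exact ⟨l, G.lift_inl hl⟩
    · obtain ⟨l, hl⟩ := hN.2 q q'
      exact ⟨e :: l, _, h, G.symm.lift_inl hl⟩
  refine ⟨⟨G.inl p⟩, fun r r' => ?_⟩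
  obtain ⟨l, hl⟩ := hto r
  obtain ⟨l', hl'⟩ := hto r'
  obtain ⟨l'', hl''⟩ := hl.exists_reverse
  exact ⟨l'' ++ l', lift_append.2 ⟨_, hl'', hl'⟩⟩

end Gluing

/-! ### Counting the indecomposable gluings -/

/-- The isomorphism classes of the connected gluings. -/
def gluings (M N : F1Rep Q) : Set (NilIso Q) :=
  {Z | Z.rep.IsConnected ∧ Nonempty (Gluing M N Z.rep)}

theorem gluings_symm (M N : F1Rep Q) : gluings M N = gluings N M := by
  ext Z
  exact and_congr_right fun _ => ⟨fun ⟨G⟩ => ⟨G.symm⟩, fun ⟨G⟩ => ⟨G.symm⟩⟩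

theorem eq_of_iso_rep {Z Z' : NilIso Q} (h : Nonempty (Z.rep ≅ Z'.rep)) : Z = Z' :=
  Quotient.out_equiv_out.1 h

section Counting

variable [Fintype Q] [∀ i j : Q, Finite (i ⟶ j)] {M N : F1Rep Q}

/-- The number of connected gluings is bounded if every connecting arrow lies on the cycle. -/
theorem card_gluings_le_of_core (hQ : Module.finrank ℤ (quiverH1 Q) ≤ 1) (hM : M.IsConnected)
    (hN : N.IsConnected)
    (hc : ∀ (R : F1Rep Q) (G : Gluing M N R) e p q, G.Conn e p q → IsCore e.2) :
    (gluings M N).Finite ∧ (gluings M N).ncard ≤ 2 ^ Nat.card (SignedArrow Q) := by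
  have G : ∀ Z : gluings M N, Gluing M N Z.1.rep := fun Z => Classical.choice Z.2.2
  -- The labels alone determine the gluing: the ends of a connecting arrow are the unique points of
  -- `M` and `N` missing `e` and `e.inv`.
  let F : gluings M N → Set (SignedArrow Q) := fun Z => {e | ∃ p q, (G Z).Conn e p q}
  have hF : Function.Injective F := by
    have key : ∀ Z Z' : gluings M N, F Z = F Z' → ∀ e p q, (G Z).Conn e p q →
        (G Z').Conn e p q := by
      intro Z Z' h e p q hpq
      have : e ∈ F Z' := h ▸ ⟨p, q, hpq⟩
      obtain ⟨p', q', hpq'⟩ := this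
      have he := hc _ _ _ _ _ hpq
      obtain rfl := Misses.unique hQ hM he hpq.misses_left hpq'.misses_left hpq.src_tgt.1
        hpq'.src_tgt.1
      obtain rfl := Misses.unique hQ hN (e := e.inv) he hpq.misses_right hpq'.misses_right
        (by rw [src_inv]; exact hpq.src_tgt.2) (by rw [src_inv]; exact hpq'.src_tgt.2)
      exact hpq'
    intro Z Z' h
    exact Subtype.ext (eq_of_iso_rep ((G Z).nonempty_iso (G Z') fun e p q =>
      ⟨key Z Z' h e p q, key Z' Z h.symm e p q⟩))
  have hfin := Finite.of_injective F hF
  refine ⟨hfin, ?_⟩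
  have := Nat.card_le_card_of_injective F hF
  rwa [show Nat.card (Set (SignedArrow Q)) = 2 ^ Nat.card (SignedArrow Q) by
    classical
    have := Fintype.ofFinite (SignedArrow Q)
    rw [Nat.card_eq_fintype_card, Nat.card_eq_fintype_card, Fintype.card_set]] at this

/-- Reduced walks from the core to `p` in `M` and from `q` to the core in `N` join through `e`
without backtracking, since `p` misses `e` and `q` misses `e.inv`. The result joins core vertices,
so it stays in the core. -/
theorem isCore_of_conn (hQ : Module.finrank ℤ (quiverH1 Q) ≤ 1)
    (hcyc : ∃ (x : Q) (l : List (SignedArrow Q)), Reduced l ∧ IsWalk x l x ∧ l ≠ [])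
    (hM : M.IsConnected) (hN : N.IsConnected) (hMc : M.MeetsCore) (hNc : N.MeetsCore)
    {R : F1Rep Q} {G : Gluing M N R} {e : SignedArrow Q} {p : M.Point} {q : N.Point}
    (h : G.Conn e p q) : IsCore e.2 := by
  obtain ⟨m, hm⟩ := hMc
  obtain ⟨n, hn⟩ := hNc
  obtain ⟨l, hl, hlm⟩ := hM.exists_reduced m p
  obtain ⟨l', hl', hln⟩ := hN.exists_reduced q n
  have hr : Reduced (l ++ e :: l') := List.isChain_split.2
    ⟨h.misses_left.reduced_concat hlm hl, h.misses_right.reduced_cons hln hl'⟩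
  have hw : IsWalk m.1 (l ++ e :: l') n.1 :=
    isWalk_append.2 ⟨_, hlm.isWalk, h.src_tgt.1, h.src_tgt.2 ▸ hln.isWalk⟩
  exact hr.isCore_of_mem hQ hcyc hm hn hw e (by simp)

/-- If `N` avoids the cycle and `M` meets it, then every gluing has a single connecting arrow,
which does not depend on the gluing, with a fixed end in `N`. -/
theorem conn_unique (hQ : Module.finrank ℤ (quiverH1 Q) ≤ 1)
    (hcyc : ∃ (x : Q) (l : List (SignedArrow Q)), Reduced l ∧ IsWalk x l x ∧ l ≠ [])
    (hM : M.IsConnected) (hN : N.IsConnected) (hMc : M.MeetsCore) (hNc : ¬ N.MeetsCore)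
    {R R' : F1Rep Q} {G : Gluing M N R} {G' : Gluing M N R'} {e e' : SignedArrow Q}
    {p p' : M.Point} {q q' : N.Point} (h : G.Conn e p q) (h' : G'.Conn e' p' q') :
    e = e' ∧ q = q' := by
  obtain ⟨m, hm⟩ := hMc
  obtain ⟨l, hl, hlm⟩ := hM.exists_reduced m p
  obtain ⟨w, hw, hwq⟩ := hN.exists_reduced q q'
  obtain ⟨l', hl', hlm'⟩ := hM.exists_reduced p' m
  have h₁ : Reduced (l ++ [e]) := h.misses_left.reduced_concat hlm hl
  have h₂ : Reduced (e :: w) := h.misses_right.reduced_cons hwq hw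
  have h₃ : Reduced (w ++ [e'.inv]) := h'.misses_right.reduced_concat hwq hw
  have h₄ : Reduced (e'.inv :: l') :=
    Misses.reduced_cons (by rw [SignedArrow.inv_inv]; exact h'.misses_left) hlm' hl'
  have hwalk : IsWalk m.1 (l ++ e :: (w ++ e'.inv :: l')) m.1 :=
    isWalk_append.2 ⟨_, hlm.isWalk, h.src_tgt.1, isWalk_append.2 ⟨_, h.src_tgt.2 ▸ hwq.isWalk,
      by rw [src_inv]; exact h'.src_tgt.2, by
      rw [tgt_inv, h'.src_tgt.1]; exact hlm'.isWalk⟩⟩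
  -- If this tail were reduced, so would be the closed walk that leaves the core through `M`,
  -- crosses into `N` and returns. Then `e` would be a core arrow and `N` would meet the core.
  have hnot : ¬ Reduced (e :: (w ++ e'.inv :: l')) := by
    intro hr
    have := Reduced.isCore_of_mem hQ hcyc hm hm (List.isChain_split.2 ⟨h₁, hr⟩) hwalk e (by simp)
    exact hNc ⟨q, e.inv, this, by rw [src_inv]; exact h.src_tgt.2⟩
  -- With `w` nonempty no new junction arises and the tail is reduced. With `w` empty the only new
  -- junction is `e`, `e'.inv`, which backtracks only if `e = e'`.
  have hw0 : w = [] := by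
    by_contra hw0
    obtain ⟨f, w, rfl⟩ := List.exists_cons_of_ne_nil hw0
    apply hnot
    have h₅ : Reduced (f :: w ++ e'.inv :: l') := List.isChain_split.2 ⟨h₃, h₄⟩
    exact List.isChain_cons_cons.2 ⟨(List.isChain_cons_cons.1 h₂).1, h₅⟩
  subst hw0
  refine ⟨?_, hwq⟩
  by_contra hne
  exact hnot (List.isChain_cons_cons.2 ⟨fun h => hne (by
    rw [← SignedArrow.inv_inv e, ← h, SignedArrow.inv_inv]), h₄⟩)

/-- Only the end in `M` of the single connecting arrow can vary, so it is an injective invariant of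
the gluing. -/
theorem card_gluings_le_dim (hQ : Module.finrank ℤ (quiverH1 Q) ≤ 1)
    (hcyc : ∃ (x : Q) (l : List (SignedArrow Q)), Reduced l ∧ IsWalk x l x ∧ l ≠ [])
    (hM : M.IsConnected) (hN : N.IsConnected) (hMc : M.MeetsCore) (hNc : ¬ N.MeetsCore) :
    (gluings M N).Finite ∧ (gluings M N).ncard ≤ M.dim := by
  have G : ∀ Z : gluings M N, Gluing M N Z.1.rep := fun Z => Classical.choice Z.2.2
  choose e p q h using fun Z => (G Z).exists_conn Z.2.1 hM.1 hN.1
  have hp : Function.Injective p := by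
    have key : ∀ Z Z' : gluings M N, p Z = p Z' → ∀ f x y, (G Z).Conn f x y →
        (G Z').Conn f x y := by
      intro Z Z' hZ f x y hf
      obtain ⟨rfl, rfl⟩ := conn_unique hQ hcyc hM hN hMc hNc hf (h Z')
      obtain ⟨h₁, h₂⟩ := conn_unique hQ hcyc hM hN hMc hNc hf (h Z)
      rw [h₁, h₂] at hf
      have hx := hf.left_unique (h Z)
      rw [hx, hZ]
      exact h Z'
    intro Z Z' hZ
    exact Subtype.ext (eq_of_iso_rep ((G Z).nonempty_iso (G Z') fun f x y =>
      ⟨key Z Z' hZ f x y, key Z' Z hZ.symm f x y⟩))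
  refine ⟨Finite.of_injective p hp, ?_⟩
  rw [dim_eq_card]
  exact Nat.card_le_card_of_injective p hp

end Counting

/-! ### Short exact sequences -/

namespace ShortExact

variable {M N R : F1Rep Q}

theorem ext' {s t : ShortExact N R M} (hf : s.f = t.f) (hg : s.g = t.g) : s = t := by
  cases s; cases t; cases hf; cases hg; rfl

theorem g_f (s : ShortExact N R M) (i : Q) (y : (N.obj i).carrier) :
    s.g.app i (s.f.app i y) = (M.obj i).zero := (s.exact i _).2 ⟨y, rfl⟩

theorem f_ne (s : ShortExact N R M) {i : Q} {y : (N.obj i).carrier} (hy : y ≠ (N.obj i).zero) :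
    s.f.app i y ≠ (R.obj i).zero := fun h =>
  hy (s.inj i (h.trans (s.f.app i).map_zero.symm))

theorem exists_lift (s : ShortExact N R M) (i : Q) (x : M.PointAt i) :
    ∃ r : R.PointAt i, s.g.app i r.1 = x.1 := by
  obtain ⟨r, hr⟩ := s.surj i x.1
  exact ⟨⟨r, fun h => x.2 (by rw [← hr, h, F1Hom.map_zero])⟩, hr⟩

/-- The points of the middle term of a short exact sequence. -/
noncomputable def toPoint (s : ShortExact N R M) (i : Q) : M.PointAt i ⊕ N.PointAt i → R.PointAt i
  | Sum.inl x => (s.exists_lift i x).choose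
  | Sum.inr y => ⟨s.f.app i y.1, s.f_ne y.2⟩

theorem g_toPoint (s : ShortExact N R M) (i : Q) (x : M.PointAt i) :
    s.g.app i (s.toPoint i (Sum.inl x)).1 = x.1 := (s.exists_lift i x).choose_spec

theorem toPoint_inr (s : ShortExact N R M) (i : Q) (y : N.PointAt i) :
    (s.toPoint i (Sum.inr y)).1 = s.f.app i y.1 := rfl

theorem toPoint_bijective (s : ShortExact N R M) (i : Q) : Function.Bijective (s.toPoint i) := by
  constructor
  · rintro (x | y) (x' | y') h
    · rw [Subtype.ext ((s.g_toPoint i x).symm.trans (h ▸ s.g_toPoint i x'))]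
    · have h1 := s.g_toPoint i x
      rw [h, toPoint_inr, g_f] at h1
      exact absurd h1.symm x.2
    · have h1 := s.g_toPoint i x'
      rw [← h, toPoint_inr, g_f] at h1
      exact absurd h1.symm x'.2
    · rw [Subtype.ext (s.inj i (congrArg Subtype.val h))]
  · rintro ⟨r, hr⟩
    by_cases h : s.g.app i r = (M.obj i).zero
    · obtain ⟨y, rfl⟩ := (s.exact i r).1 h
      exact ⟨Sum.inr ⟨y, fun hy => hr (by rw [hy, F1Hom.map_zero])⟩, rfl⟩
    · refine ⟨Sum.inl ⟨_, h⟩, Subtype.ext ?_⟩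
      exact ((s.g.app i).inj _ _ h (s.g_toPoint i ⟨_, h⟩).symm).symm

/-- The middle term of a short exact sequence is a gluing of the outer terms. -/
noncomputable def gluing (s : ShortExact N R M) : Gluing M N R where
  equiv i := Equiv.ofBijective (s.toPoint i) (s.toPoint_bijective i)
  map_inl {i j} α x y := by
    change R.map α (s.toPoint i (Sum.inl x)).1 = (s.toPoint j (Sum.inl y)).1 ↔ _
    have hy := s.g_toPoint j y
    have hn := s.g.naturality_apply α (s.toPoint i (Sum.inl x)).1
    rw [g_toPoint] at hn
    constructor
    · intro h
      rw [← hn, h, hy]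
    · intro h
      refine (s.g.app j).inj _ _ ?_ ?_
      · rw [hn, h]; exact y.2
      · rw [hn, h, hy]
  map_inr {i j} α x y := by
    change R.map α (s.f.app i x.1) = s.f.app j y.1 ↔ _
    rw [← s.f.naturality_apply α x.1]
    exact (s.inj j).eq_iff

theorem gluing_inl (s : ShortExact N R M) {i : Q} (x : M.PointAt i) :
    s.g.app i (s.gluing.equiv i (Sum.inl x)).1 = x.1 := s.g_toPoint i x

end ShortExact

/-- The short exact sequence of a gluing without connecting arrows. -/
theorem Gluing.exists_shortExact {M N R : F1Rep Q} (G : Gluing M N R)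
    (hG : ¬ ∃ e p q, G.Conn e p q) : ∃ t : ShortExact M R N,
      (∀ i (x : M.PointAt i), t.f.app i x.1 = (G.equiv i (Sum.inl x)).1) ∧
      ∀ i (y : N.PointAt i), t.g.app i (G.equiv i (Sum.inr y)).1 = y.1 := by
  classical
  let f : ∀ i, (M.obj i).carrier → (R.obj i).carrier := fun i x =>
    if h : x = (M.obj i).zero then (R.obj i).zero else (G.equiv i (Sum.inl ⟨x, h⟩)).1
  let g : ∀ i, (R.obj i).carrier → (N.obj i).carrier := fun i r =>
    if h : r = (R.obj i).zero then (N.obj i).zero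
    else Sum.elim (fun _ => (N.obj i).zero) Subtype.val ((G.equiv i).symm ⟨r, h⟩)
  have f0 : ∀ i, f i (M.obj i).zero = (R.obj i).zero := fun i => dif_pos rfl
  have f1 : ∀ i (x : M.PointAt i), f i x.1 = (G.equiv i (Sum.inl x)).1 := fun i x => dif_neg x.2
  have g0 : ∀ i, g i (R.obj i).zero = (N.obj i).zero := fun i => dif_pos rfl
  have g1 : ∀ i (x : M.PointAt i), g i (G.equiv i (Sum.inl x)).1 = (N.obj i).zero := by
    intro i x
    refine (dif_neg (G.equiv i (Sum.inl x)).2).trans ?_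
    simp
  have g2 : ∀ i (y : N.PointAt i), g i (G.equiv i (Sum.inr y)).1 = y.1 := by
    intro i x
    refine (dif_neg (G.equiv i (Sum.inr x)).2).trans ?_
    simp
  have cases_R : ∀ i (r : (R.obj i).carrier), r = (R.obj i).zero ∨
      (∃ x, r = (G.equiv i (Sum.inl x)).1) ∨ ∃ y, r = (G.equiv i (Sum.inr y)).1 := by
    intro i r
    by_cases h : r = (R.obj i).zero
    · exact Or.inl h
    · obtain ⟨x | y, hxy⟩ := (G.equiv i).surjective ⟨r, h⟩
      · exact Or.inr (Or.inl ⟨x, by rw [hxy]⟩)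
      · exact Or.inr (Or.inr ⟨y, by rw [hxy]⟩)
  have finj : ∀ i, Function.Injective (f i) := by
    intro i x y h
    by_cases hx : x = (M.obj i).zero <;> by_cases hy : y = (M.obj i).zero
    · rw [hx, hy]
    · rw [hx, f0, f1 i ⟨y, hy⟩] at h
      exact absurd h.symm (G.equiv i _).2
    · rw [hy, f0, f1 i ⟨x, hx⟩] at h
      exact absurd h (G.equiv i _).2
    · rw [f1 i ⟨x, hx⟩, f1 i ⟨y, hy⟩] at h
      simpa using (G.equiv i).injective (Subtype.ext h)
  -- Without connecting arrows the image of a point of `M` is zero or again a point of `M`, so `f`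
  -- commutes with the structure maps.
  have hx : ∀ {i j : Q} (α : i ⟶ j) (x : M.PointAt i),
      R.map α (G.equiv i (Sum.inl x)).1 = f j (M.map α x.1) := by
    intro i j α x
    rcases cases_R j (R.map α (G.equiv i (Sum.inl x)).1) with h | ⟨y, h⟩ | ⟨y, h⟩
    · by_cases hy : M.map α x.1 = (M.obj j).zero
      · rw [h, hy, f0]
      · rw [f1 j ⟨_, hy⟩]
        exact (G.map_inl α x ⟨_, hy⟩).2 rfl
    · rw [h, (G.map_inl α x y).1 h, f1]
    · exact absurd ⟨_, _, _, Gluing.conn_true_iff.2 h⟩ hG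
  have hy : ∀ {i j : Q} (α : i ⟶ j) (y : N.PointAt i),
      g j (R.map α (G.equiv i (Sum.inr y)).1) = N.map α y.1 := by
    intro i j α x
    rcases cases_R j (R.map α (G.equiv i (Sum.inr x)).1) with h | ⟨y, h⟩ | ⟨y, h⟩
    · rw [h, g0]
      by_contra hne
      have := (G.map_inr α x ⟨_, fun h => hne h.symm⟩).2 rfl
      exact (G.equiv j _).2 (this.symm.trans h)
    · exact absurd ⟨_, _, _, Gluing.conn_false_iff.2 h⟩ hG
    · rw [h, g2, (G.map_inr α x y).1 h]
  refine ⟨⟨⟨fun i => ⟨f i, f0 i, fun x y _ h => finj i h⟩, ?_⟩,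
    ⟨fun i => ⟨g i, g0 i, ?_⟩, ?_⟩, finj, ?_, ?_⟩, f1, g2⟩
  · intro i j α
    apply F1Hom.ext
    funext x
    change f j (M.map α x) = R.map α (f i x)
    by_cases h : x = (M.obj i).zero
    · rw [h, f0, F1Hom.map_zero, F1Hom.map_zero, f0]
    · rw [f1 i ⟨x, h⟩, hx]
  · intro r r' h0 h
    rcases cases_R i r with rfl | ⟨x, rfl⟩ | ⟨y, rfl⟩
    · exact absurd (g0 i) h0
    · exact absurd (g1 i x) h0
    · rw [g2] at h h0
      rcases cases_R i r' with rfl | ⟨x, rfl⟩ | ⟨y', rfl⟩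
      · exact absurd (h.trans (g0 i)) h0
      · exact absurd (h.trans (g1 i x)) h0
      · rw [g2] at h
        rw [Subtype.ext h]
  · intro i j α
    apply F1Hom.ext
    funext r
    change g j (R.map α r) = N.map α (g i r)
    rcases cases_R i r with rfl | ⟨x, rfl⟩ | ⟨y, rfl⟩
    · rw [F1Hom.map_zero, g0, g0, F1Hom.map_zero]
    · rw [hx, g1, F1Hom.map_zero]
      by_cases h : M.map α x.1 = (M.obj j).zero
      · rw [h, f0, g0]
      · rw [f1 j ⟨_, h⟩, g1]
    · rw [hy, g2]
  · intro i y
    by_cases h : y = (N.obj i).zero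
    · exact ⟨_, (g0 i).trans h.symm⟩
    · exact ⟨_, g2 i ⟨y, h⟩⟩
  · intro i r
    change g i r = _ ↔ ∃ y, f i y = r
    constructor
    · intro h
      rcases cases_R i r with rfl | ⟨x, rfl⟩ | ⟨y, rfl⟩
      · exact ⟨_, f0 i⟩
      · exact ⟨_, f1 i x⟩
      · exact absurd ((g2 i y).symm.trans h) y.2
    · rintro ⟨x, rfl⟩
      by_cases h : x = (M.obj i).zero
      · rw [h, f0, g0]
      · rw [f1 i ⟨x, h⟩, g1]

namespace ShortExact

variable {M N R : F1Rep Q}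

instance [Finite Q] : Finite (F1RepHom M N) :=
  Finite.of_injective F1RepHom.app fun _ _ h => F1RepHom.ext h

instance [Finite Q] : Finite (ShortExact N R M) :=
  Finite.of_injective (fun s => (s.f, s.g)) fun _ _ h =>
    ext' (congrArg Prod.fst h) (congrArg Prod.snd h)

/-- A short exact sequence with connected ends and disconnected middle term splits. -/
theorem exists_swap (s : ShortExact N R M) (hM : M.IsConnected) (hN : N.IsConnected)
    (hR : ¬ R.IsConnected) : ∃ t : ShortExact M R N,
      (∀ i x, s.g.app i (t.f.app i x) = x) ∧ ∀ i y, t.g.app i (s.f.app i y) = y := by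
  obtain ⟨t, h₁, h₂⟩ := s.gluing.exists_shortExact fun h => hR (s.gluing.isConnected hM hN h)
  refine ⟨t, fun i x => ?_, fun i y => ?_⟩
  · by_cases hx : x = (M.obj i).zero
    · rw [hx, F1Hom.map_zero, F1Hom.map_zero]
    · rw [h₁ i ⟨x, hx⟩, gluing_inl]
  · by_cases hy : y = (N.obj i).zero
    · rw [hy, F1Hom.map_zero, F1Hom.map_zero]
    · exact h₂ i ⟨y, hy⟩

/-- The swapped sequence remembers the original: off its kernel `s.g` inverts `t.f`, and `s.f` is a
section of `t.g`, which is injective off its own kernel. -/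
theorem eq_of_swap {s s' : ShortExact N R M} {t : ShortExact M R N}
    (h₁ : ∀ i x, s.g.app i (t.f.app i x) = x) (h₂ : ∀ i y, t.g.app i (s.f.app i y) = y)
    (h₁' : ∀ i x, s'.g.app i (t.f.app i x) = x)
    (h₂' : ∀ i y, t.g.app i (s'.f.app i y) = y) : s = s' := by
  have key : ∀ {s s' : ShortExact N R M}, (∀ i x, s.g.app i (t.f.app i x) = x) →
      (∀ i x, s'.g.app i (t.f.app i x) = x) → ∀ i r, s.g.app i r ≠ (M.obj i).zero →
        s'.g.app i r = s.g.app i r := by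
    intro s s' h h' i r hr
    have : r = t.f.app i (s.g.app i r) := (s.g.app i).inj _ _ hr (h i _).symm
    rw [this, h', h]
  apply ext'
  · apply F1RepHom.ext
    funext i
    apply F1Hom.ext
    funext y
    by_cases hy : y = (N.obj i).zero
    · rw [hy, F1Hom.map_zero, F1Hom.map_zero]
    · exact (t.g.app i).inj _ _ (by rw [h₂]; exact hy) (by rw [h₂, h₂'])
  · apply F1RepHom.ext
    funext i
    apply F1Hom.ext
    funext r
    by_cases hr : s.g.app i r = (M.obj i).zero
    · by_cases hr' : s'.g.app i r = (M.obj i).zero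
      · rw [hr, hr']
      · exact key h₁' h₁ i r hr'
    · exact (key h₁ h₁' i r hr).symm

/-- Applied in both orders, this gives the equality that removes disconnected middle terms from the
commutator. -/
theorem card_le_card_swap [Finite Q] (hM : M.IsConnected) (hN : N.IsConnected)
    (hR : ¬ R.IsConnected) : Nat.card (ShortExact N R M) ≤ Nat.card (ShortExact M R N) := by
  choose t h₁ h₂ using fun s : ShortExact N R M => s.exists_swap hM hN hR
  refine Nat.card_le_card_of_injective t fun s s' h => ?_
  have h₁' := h₁ s'
  have h₂' := h₂ s'
  rw [← h] at h₁' h₂'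
  exact eq_of_swap (h₁ s) (h₂ s) h₁' h₂'

/-- The automorphisms of the ends act on the short exact sequences. -/
instance : MulAction (Aut N × Aut M) (ShortExact N R M) where
  smul σ s :=
    { f := (σ.1.inv ≫ (show N ⟶ R from s.f) : N ⟶ R)
      g := ((show R ⟶ M from s.g) ≫ σ.2.hom : R ⟶ M)
      inj := fun i => (s.inj i).comp
        (Function.LeftInverse.injective (iso_hom_inv_apply σ.1 i))
      surj := fun i => (Function.RightInverse.surjective (iso_hom_inv_apply σ.2 i)).comp (s.surj i)
      exact := fun i r => by
        change F1RepHom.app σ.2.hom i (s.g.app i r) = _ ↔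
          ∃ y, s.f.app i (F1RepHom.app σ.1.inv i y) = r
        constructor
        · intro h
          have h1 := iso_inv_hom_apply σ.2 i (s.g.app i r)
          rw [h, F1Hom.map_zero] at h1
          obtain ⟨y, rfl⟩ := (s.exact i r).1 h1.symm
          exact ⟨_, congrArg (s.f.app i).toFun (iso_inv_hom_apply σ.1 i y)⟩
        · rintro ⟨y, rfl⟩
          rw [g_f, F1Hom.map_zero] }
  one_smul _ := rfl
  mul_smul _ _ _ := rfl

/-- The action of the automorphisms is free because the first map is injective and the second
surjective; `k` is the number of orbits. -/
theorem exists_card_eq (M N R : F1Rep Q) :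
    ∃ k : ℕ, Nat.card (ShortExact N R M) = k * (autCard M * autCard N) := by
  have h : ∀ s : ShortExact N R M, MulAction.stabilizer (Aut N × Aut M) s = ⊥ := by
    intro s
    rw [Subgroup.eq_bot_iff_forall]
    rintro ⟨σ, τ⟩ hs
    rw [MulAction.mem_stabilizer_iff] at hs
    have hf : ∀ i y, s.f.app i (F1RepHom.app σ.inv i y) = s.f.app i y := fun i y =>
      congrArg (fun t : ShortExact N R M => t.f.app i y) hs
    have hg : ∀ i r, F1RepHom.app τ.hom i (s.g.app i r) = s.g.app i r := fun i r =>
      congrArg (fun t : ShortExact N R M => t.g.app i r) hs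
    refine Prod.ext (Iso.ext ?_) (Iso.ext ?_)
    · refine F1RepHom.ext <| funext fun i => F1Hom.ext <| funext fun y => ?_
      have := s.inj i (hf i (F1RepHom.app σ.hom i y))
      exact this.symm.trans (iso_inv_hom_apply σ i y)
    · refine F1RepHom.ext <| funext fun i => F1Hom.ext <| funext fun x => ?_
      obtain ⟨r, rfl⟩ := s.surj i x
      exact hg i r
  refine ⟨Nat.card (Quotient (MulAction.orbitRel (Aut N × Aut M) (ShortExact N R M))),
    (Nat.card_congr (MulAction.selfEquivOrbitsQuotientProd h)).trans ?_⟩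
  rw [Nat.card_prod, Nat.card_prod, autCard, autCard, mul_comm (Nat.card (Aut N))]

end ShortExact

end F1Rep

open SignedArrow

/-! ### The bracket -/

section Bracket

variable {Q : Type u} [Quiver.{v} Q]

theorem NilIso.rep_isNilpotent (Z : NilIso Q) : Z.rep.IsNilpotent :=
  (Quotient.out (s := nilSetoid Q) Z).2

/-- The isomorphism class of a nilpotent representation. -/
def NilIso.mk (M : F1Rep Q) (hM : M.IsNilpotent) : NilIso Q :=
  Quotient.mk (nilSetoid Q) ⟨M, hM⟩

theorem NilIso.nonempty_iso_rep (M : F1Rep Q) (hM : M.IsNilpotent) :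
    Nonempty (M ≅ (NilIso.mk M hM).rep) :=
  (nilSetoid Q).symm (Quotient.mk_out (s := nilSetoid Q) ⟨M, hM⟩)

theorem hallClass_eq_single (M : F1Rep Q) (hM : M.IsNilpotent) :
    hallClass M hM = Finsupp.single (NilIso.mk M hM) 1 := rfl

theorem hallClass_rep (Z : NilIso Q) (h : Z.rep.IsNilpotent) :
    hallClass Z.rep h = Finsupp.single Z 1 := by
  unfold hallClass
  congr 1
  exact Quotient.out_eq (s := nilSetoid Q) Z

variable [Finite Q] [∀ i j : Q, Finite (i ⟶ j)]

theorem hallMul_single (X Y : NilIso Q) :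
    hallMul (Finsupp.single X 1) (Finsupp.single Y 1) = hallProd X Y := by
  simp [hallMul]

theorem hallProd_apply (X Y Z : NilIso Q) : hallProd X Y Z =
    (Nat.card (F1Rep.ShortExact Y.rep Z.rep X.rep) : ℂ) /
      ((autCard X.rep : ℂ) * (autCard Y.rep : ℂ)) := rfl

theorem exists_hallProd_apply_eq (X Y Z : NilIso Q) : ∃ k : ℕ, hallProd X Y Z = k := by
  obtain ⟨k, hk⟩ := F1Rep.ShortExact.exists_card_eq X.rep Y.rep Z.rep
  rw [hallProd_apply, hk]
  -- Division by zero has value zero, so the quotient is a natural number without first proving the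
  -- denominator nonzero.
  by_cases h : (autCard X.rep : ℂ) * (autCard Y.rep : ℂ) = 0
  · exact ⟨0, by simp [h]⟩
  · exact ⟨k, by push_cast; rw [mul_div_cancel_right₀ _ h]⟩

theorem hallProd_apply_comm {X Y Z : NilIso Q} (hX : X.rep.IsConnected)
    (hY : Y.rep.IsConnected) (hZ : ¬ Z.rep.IsConnected) : hallProd X Y Z = hallProd Y X Z := by
  rw [hallProd_apply, hallProd_apply, mul_comm (autCard X.rep : ℂ),
    le_antisymm (F1Rep.ShortExact.card_le_card_swap hX hY hZ)
      (F1Rep.ShortExact.card_le_card_swap hY hX hZ)]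

theorem nonempty_gluing_of_hallProd {X Y Z : NilIso Q} (h : hallProd X Y Z ≠ 0) :
    Nonempty (F1Rep.Gluing X.rep Y.rep Z.rep) := by
  by_contra hc
  have : IsEmpty (F1Rep.ShortExact Y.rep Z.rep X.rep) := ⟨fun s => hc ⟨s.gluing⟩⟩
  exact h (by simp [hallProd_apply])

theorem mem_gluings_of_bracket {X Y Z : NilIso Q} (hX : X.rep.IsConnected)
    (hY : Y.rep.IsConnected) (h : (hallProd X Y - hallProd Y X) Z ≠ 0) :
    Z ∈ F1Rep.gluings X.rep Y.rep := by
  rw [Finsupp.sub_apply] at h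
  -- Disconnected terms cancel, so `Z` is connected; one of the two products is nonzero at `Z`, and
  -- its sequences supply the gluing.
  refine ⟨?_, ?_⟩
  · by_contra hZ
    exact h (sub_eq_zero.2 (hallProd_apply_comm hX hY hZ))
  · by_cases h1 : hallProd X Y Z = 0
    · obtain ⟨G⟩ := nonempty_gluing_of_hallProd (X := Y) (Y := X) (Z := Z)
        fun h2 => h (by rw [h1, h2, sub_zero])
      exact ⟨G.symm⟩
    · exact nonempty_gluing_of_hallProd h1

theorem isIntComb_of_card_gluings_le {X Y : NilIso Q} (hX : X.rep.IsConnected)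
    (hY : Y.rep.IsConnected) {B : ℕ} (hfin : (F1Rep.gluings X.rep Y.rep).Finite)
    (hB : (F1Rep.gluings X.rep Y.rep).ncard ≤ B) :
    IsIntCombOfIndecomposables B (hallProd X Y - hallProd Y X) := by
  have hmem : ∀ Z ∈ (hallProd X Y - hallProd Y X).support, Z ∈ F1Rep.gluings X.rep Y.rep :=
    fun Z hZ => mem_gluings_of_bracket hX hY (Finsupp.mem_support_iff.1 hZ)
  have hint : ∀ Z, ∃ c : ℤ, (hallProd X Y - hallProd Y X) Z = c := by
    intro Z
    obtain ⟨k, hk⟩ := exists_hallProd_apply_eq X Y Z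
    obtain ⟨l, hl⟩ := exists_hallProd_apply_eq Y X Z
    exact ⟨k - l, by rw [Finsupp.sub_apply, hk, hl]; push_cast; rfl⟩
  choose c hc using hint
  generalize hallProd X Y - hallProd Y X = D at hmem hc
  have hcard : D.support.card ≤ B := by
    refine le_trans ?_ hB
    rw [← Set.ncard_coe_finset]
    exact Set.ncard_le_ncard hmem hfin
  let e := D.support.equivFin
  refine ⟨D.support.card, hcard, fun k => c (e.symm k), fun k => (e.symm k).1.rep,
    fun k => NilIso.rep_isNilpotent _, fun k => (hmem _ (e.symm k).2).1.indecomposable, ?_⟩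
  simp only [hallClass_rep]
  rw [Equiv.sum_comp e.symm fun Z : D.support => c Z • (Finsupp.single Z.1 1 : HallAlg Q),
    Finset.sum_coe_sort D.support fun Z => c Z • (Finsupp.single Z 1 : HallAlg Q)]
  conv_lhs => rw [← Finsupp.sum_single D]
  refine Finset.sum_congr rfl fun Z _ => ?_
  rw [Finsupp.smul_single, hc Z]
  simp

end Bracket

/-! ### The three types of pseudotrees -/

section Types

variable {Q : Type u} [Quiver.{v} Q]

/-- Going once around the cycle gives a 1-cycle with coefficient `±1` at every arrow; its boundary
vanishes by the index shift `i ↦ i + 1`. -/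
theorem IsTypeATilde.isCoreVertex (h : IsTypeATilde Q) (x : Q) : IsCoreVertex x := by
  classical
  obtain ⟨n, hn, e, a, h⟩ := h
  have : NeZero n := ⟨by omega⟩
  have hs : ∀ i, ∃ s : SignedArrow Q, s.2 = a i ∧ s.src = e i ∧ s.tgt = e (i + 1) := by
    intro i
    rcases h i with ⟨h₁, h₂⟩ | ⟨h₁, h₂⟩
    · exact ⟨(true, a i), rfl, h₁, h₂⟩
    · exact ⟨(false, a i), rfl, h₂, h₁⟩
  choose s hs₁ hs₂ hs₃ using hs
  have hchain : ∀ i, chain [s i] = Finsupp.single (a i) (if (s i).1 then 1 else -1) := by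
    intro i
    simp [chain, hs₁]
  have hz : ∑ i, chain [s i] ∈ quiverH1 Q := by
    have hb : ∀ i, quiverBoundary Q (chain [s i]) =
        Finsupp.single (e (i + 1)) 1 - Finsupp.single (e i) 1 := fun i =>
      boundary_chain ⟨hs₂ i, hs₃ i⟩
    rw [LinearMap.mem_ker, map_sum, Finset.sum_congr rfl fun i _ => hb i,
      Finset.sum_sub_distrib, sub_eq_zero]
    exact Equiv.sum_comp (Equiv.addRight (1 : ZMod n)) fun i => Finsupp.single (e i) (1 : ℤ)
  obtain ⟨i, rfl⟩ := e.surjective x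
  refine ⟨s i, ⟨_, hz, ?_⟩, hs₂ i⟩
  rw [Finsupp.finsetSum_apply, Finset.sum_eq_single i, hchain, hs₁, Finsupp.single_eq_same]
  · split_ifs <;> norm_num
  · intro j _ hj
    rw [hchain, hs₁, Finsupp.single_eq_of_ne fun h => hj (a.injective h).symm]
  · simp

variable [Fintype Q]

theorem F1Rep.IsConnected.exists_closed_walk {M : F1Rep Q} (hM : M.IsConnected)
    (hd : Fintype.card Q < M.dim) :
    ∃ (x : Q) (l : List (SignedArrow Q)), Reduced l ∧ IsWalk x l x ∧ l ≠ [] := by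
  obtain ⟨p, q, l, hpq, hl, h, h0⟩ := hM.exists_reduced_closed hd
  have hw := h.isWalk
  rw [← hpq] at hw
  exact ⟨_, l, hl, hw, h0⟩

/-- A larger dimension would produce a reduced closed walk, hence a nonzero 1-cycle. -/
theorem IsTreeQuiver.dim_le (hQ : IsTreeQuiver Q) {M : F1Rep Q} (hM : M.IsConnected) :
    M.dim ≤ Fintype.card Q := by
  by_contra hd
  obtain ⟨x, l, hl, hw, h0⟩ := hM.exists_closed_walk (not_le.1 hd)
  obtain ⟨v, w, h₁, h₂, -, h₄⟩ := hl.exists_cycle hw h0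
  have h5 := chain_mem h₂
  rw [hQ.2, Submodule.mem_bot] at h5
  obtain ⟨e, he⟩ := List.exists_mem_of_ne_nil _ h₁
  exact h₄ e he (by simp [h5])

variable [∀ i j : Q, Finite (i ⟶ j)]

theorem card_gluings_le_of_large (hQ : Module.finrank ℤ (quiverH1 Q) ≤ 1) {M N : F1Rep Q}
    (hM : M.IsConnected) (hN : N.IsConnected) (hd : Fintype.card Q < M.dim) :
    (F1Rep.gluings M N).Finite ∧
      (F1Rep.gluings M N).ncard ≤ max (2 ^ Nat.card (SignedArrow Q)) M.dim := by
  have hcyc := hM.exists_closed_walk hd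
  have hMc := hM.meetsCore hd
  by_cases hNc : N.MeetsCore
  · exact (F1Rep.card_gluings_le_of_core hQ hM hN fun _ _ _ _ _ h =>
      F1Rep.isCore_of_conn hQ hcyc hM hN hMc hNc h).imp_right fun h => h.trans (le_max_left _ _)
  · exact (F1Rep.card_gluings_le_dim hQ hcyc hM hN hMc hNc).imp_right fun h =>
      h.trans (le_max_right _ _)

theorem card_gluings_le_max (hQ : Module.finrank ℤ (quiverH1 Q) ≤ 1) {M N : F1Rep Q}
    (hM : M.IsConnected) (hN : N.IsConnected) (hd : Fintype.card Q < max M.dim N.dim) :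
    (F1Rep.gluings M N).Finite ∧
      (F1Rep.gluings M N).ncard ≤ max (2 ^ Nat.card (SignedArrow Q)) (max M.dim N.dim) := by
  rcases lt_max_iff.1 hd with hd | hd
  · exact (card_gluings_le_of_large hQ hM hN hd).imp_right fun h =>
      h.trans (max_le_max_left _ (le_max_left _ _))
  · rw [F1Rep.gluings_symm]
    exact (card_gluings_le_of_large hQ hN hM hd).imp_right fun h =>
      h.trans (max_le_max_left _ (le_max_right _ _))

theorem IsTypeATilde.card_gluings_le (hA : IsTypeATilde Q)
    (hQ : Module.finrank ℤ (quiverH1 Q) ≤ 1) {M N : F1Rep Q}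
    (hM : M.IsConnected) (hN : N.IsConnected) (hd : Fintype.card Q < max M.dim N.dim) :
    (F1Rep.gluings M N).Finite ∧
      (F1Rep.gluings M N).ncard ≤ 2 ^ Nat.card (SignedArrow Q) := by
  have hcyc : ∃ (x : Q) (l : List (SignedArrow Q)), Reduced l ∧ IsWalk x l x ∧ l ≠ [] :=
    (lt_max_iff.1 hd).elim hM.exists_closed_walk hN.exists_closed_walk
  obtain ⟨p⟩ := hM.1
  obtain ⟨q⟩ := hN.1
  exact F1Rep.card_gluings_le_of_core hQ hM hN fun _ _ _ _ _ h =>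
    F1Rep.isCore_of_conn hQ hcyc hM hN ⟨p, hA.isCoreVertex _⟩ ⟨q, hA.isCoreVertex _⟩ h

/-- The product is defined through chosen representatives, so the bound is required for all
connected representations of the same dimensions. -/
theorem isIntComb_hallBracket {M N : F1Rep Q} (hM : M.IsNilpotent) (hN : N.IsNilpotent)
    (hMi : M.Indecomposable) (hNi : N.Indecomposable) {B : ℕ}
    (hB : ∀ M' N' : F1Rep Q, M'.IsConnected → N'.IsConnected → M'.dim = M.dim →
      N'.dim = N.dim → (F1Rep.gluings M' N').Finite ∧ (F1Rep.gluings M' N').ncard ≤ B) :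
    IsIntCombOfIndecomposables B (hallBracket (hallClass N hN) (hallClass M hM)) := by
  obtain ⟨e⟩ := NilIso.nonempty_iso_rep M hM
  obtain ⟨f⟩ := NilIso.nonempty_iso_rep N hN
  have hMc := (hMi.of_iso e).isConnected
  have hNc := (hNi.of_iso f).isConnected
  obtain ⟨h₁, h₂⟩ := hB _ _ hMc hNc (F1Rep.dim_eq_of_iso e).symm (F1Rep.dim_eq_of_iso f).symm
  rw [F1Rep.gluings_symm] at h₁ h₂
  rw [hallBracket, hallClass_eq_single, hallClass_eq_single, hallMul_single, hallMul_single]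
  exact isIntComb_of_card_gluings_le hNc hMc h₁ h₂

end Types

theorem mainTheorem8 (Q : Type u) [Quiver.{v} Q] [Fintype Q] [∀ i j : Q, Finite (i ⟶ j)]
    (hQ : IsPseudotree Q) :
    (IsTreeQuiver Q → ∃ K : ℕ, ∀ (M N : F1Rep Q) (hM : M.IsNilpotent) (hN : N.IsNilpotent),
      M.Indecomposable → N.Indecomposable → K ≤ max M.dim N.dim →
        hallBracket (hallClass N hN) (hallClass M hM) = 0) ∧
    (IsTypeATilde Q → ∃ K B : ℕ, ∀ (M N : F1Rep Q) (hM : M.IsNilpotent) (hN : N.IsNilpotent),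
      M.Indecomposable → N.Indecomposable → K ≤ max M.dim N.dim →
        IsIntCombOfIndecomposables B (hallBracket (hallClass N hN) (hallClass M hM))) ∧
    (IsProperPseudotree Q → ∃ K : ℕ, ∀ (M N : F1Rep Q) (hM : M.IsNilpotent) (hN : N.IsNilpotent),
      M.Indecomposable → N.Indecomposable → K ≤ max M.dim N.dim →
        IsIntCombOfIndecomposables (max M.dim N.dim)
          (hallBracket (hallClass N hN) (hallClass M hM))) := by
  -- The threshold `Fintype.card Q + 1` forces a reduced closed walk. In the proper case `K` also
  -- dominates `2 ^ Nat.card (SignedArrow Q)`, so the maximum of the two bounds is the dimension.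
  refine ⟨fun hT => ⟨Fintype.card Q + 1, fun M N _ _ hMi hNi hd => ?_⟩,
    fun hA => ⟨Fintype.card Q + 1, 2 ^ Nat.card (SignedArrow Q), fun M N hM hN hMi hNi hd =>
      isIntComb_hallBracket hM hN hMi hNi fun M' N' hM' hN' h₁ h₂ =>
        hA.card_gluings_le hQ.2 hM' hN' (by rw [h₁, h₂]; exact hd)⟩,
    fun _ => ⟨max (Fintype.card Q + 1) (2 ^ Nat.card (SignedArrow Q)),
      fun M N hM hN hMi hNi hd => isIntComb_hallBracket hM hN hMi hNi fun M' N' hM' hN' h₁ h₂ => ?_⟩⟩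
  · have h₁ := hT.dim_le hMi.isConnected
    have h₂ := hT.dim_le hNi.isConnected
    exact absurd hd (by rw [not_le, Nat.lt_succ_iff]; exact max_le h₁ h₂)
  · have h := card_gluings_le_max hQ.2 hM' hN'
      (by rw [h₁, h₂]; exact (le_max_left _ _).trans hd)
    rw [h₁, h₂, max_eq_right ((le_max_right _ _).trans hd)] at h
    exact h
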